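/- **Model.** Let $\mathcal E$ be a finite set of events. A pattern ($l$-gram) is a non-empty sequence $w=[e_1\,\dots\,e_l]$ of events; a dictionary $\mathcal D$ is a finite set of patterns. A separation of a sentence $E$ over $\mathcal D$ is an ordered sequence $S$ of distinct patterns of $\mathcal D$ whose concatenation is $E$; $\mathcal F(E)$ is the set of all separations of $E$, and $n_S$ is the number of patterns in $S$. The parameters of the latent theme dictionary model with $J$ classes and dictionary $\mathcal D$ are $\Theta=(\{\theta_{jw}\},\{\lambda_j\},\pi,\kappa)$ with $\theta_{jw}\in[0,1]$ ($1\le j\le J$, $w\in\mathcal D$), $\lambda_j>0$, $\pi_j>0$, $\sum_j\pi_j=1$, $\kappa>0$. For each examinee the number $K$ of sentences is Poisson($\kappa$) and, independently, the latent class $z$ has law $\pi$; given $(K,z)$ the $K$ sentences are independent; each arises from a separation $S$ with probability $P(S|z)=\frac1{n_S!}\prod_{w\in\mathcal D}\theta_{zw}^{1\{w\in S\}}(1-\theta_{zw})^{1\{w\notin S\}}$, and its gap times, one per event, are independent exponential variables with rate $\lambda_z$. Only the event sentences $E_k$ and the gap times $\tilde t_{k,u}$ are observed, so the likelihood of one examinee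 is $$L(\mathcal D,\Theta)=\frac{\kappa^Ke^{-\kappa}}{K!}\sum_{z=1}^J\pi_z\prod_{k=1}^K\Big\{\sum_{S\in\mathcal F(E_k)}P(S|z)\Big\}\prod_u\lambda_ze^{-\lambda_z\tilde t_{k,u}} .$$ **Assumptions on the true model** $(\mathcal D^*,\Theta^*)$ (asterisks are omitted in A1, A2, C1, C2). The numbers $J$ and $v_D=|\mathcal D^*|$ are known. Every $\theta^*_{jw}<1$, every pattern $w\in\mathcal D^*$ has $\theta^*_{jw}>0$ for some $j$, and every class $j$ has $\theta^*_{jw}>0$ for some $w$. Let $[j]=\{i:\lambda_i=\lambda_j\}$, let $\mathcal O_j$ be the set of sentences that have a separation using only patterns $w$ with $\theta_{jw}\ne0$, and $\mathcal O_{[j]}=\bigcup_{i\in[j]}\mathcal O_i$. * A1: for all $j$ and all events $e$, if $E\in\mathcal O_{[j]}$ contains as consecutive events a sentence $E_1\in\mathcal O_j$ that avoids $e$ and has the maximal length among the sentences of $\mathcal O_j$ avoiding $e$, then $E\in\mathcal O_j$. * A2: in every pattern of length at least $2$ the events are distinct. * C1: for each $[j]$ with $|[j]|>1$ there is a partition $\mathcal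 I_1,\mathcal I_2,\mathcal I_3$ of the 1-grams of $\mathcal D$ with $|\mathcal I_k|\ge|[j]|$ such that every sentence $(e,f)$ with $e\in\mathcal I_k$, $f\in\mathcal I_l$, $k\ne l$, and every sentence $(e_1,e_2,e_3)$ with $e_k\in\mathcal I_k$ has exactly one separation, and each of the matrices $\big(\theta_{ie}/(1-\theta_{ie})\big)_{e\in\mathcal I_k,\,i\in[j]}$, $k=1,2,3$, has full column rank. * C2: for each $[j]$ with $|[j]|>1$ and each $l$-gram $w=[e_1\dots e_l]\in\mathcal D$, $l\ge2$, there is a set $\mathcal D_{[j],w}$ of at least $|[j]|$ 1-grams of $\mathcal D$ such that for $e\in\mathcal D_{[j],w}$ no separation of $(e_1,\dots,e_l,e)$ other than $(w,[e])$ contains an $(l+1)$-gram or an $l$-gram different from $w$, and the matrix $\big(\theta_{ie}/(1-\theta_{ie})\big)_{e\in\mathcal D_{[j],w},\,i\in[j]}$ has full column rank. **Theorem.** Let the observations of examinees $1,2,\dots$ be independent with the law of the model $(\mathcal D^*,\Theta^*)$. For each dictionary $\mathcal D$ let $\boldsymbol\Theta_c(\mathcal D)$ be a compact set of parameters over $\mathcal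 D$, with $\Theta^*\in\boldsymbol\Theta_c(\mathcal D^*)$. Let $\mathfrak C$ be the set of all $(\mathcal D,\Theta)$ such that $\mathcal D$ satisfies A2, $|\mathcal D|\le v_D$ and $\Theta\in\boldsymbol\Theta_c(\mathcal D)$. Then for every $m$ and all data the likelihood $\prod_{i=1}^mL_i$ has a maximizer over $\mathfrak C$. Moreover, let $\mathfrak P_c$ be $\mathfrak C$, or any subset of it that contains $(\mathcal D^*,\Theta^*)$ (for instance the elements of $\mathfrak C$ that satisfy A1), and for each $m$ let $(\hat{\mathcal D},\{\hat\theta_{jw}\},\{\hat\lambda_j\},\hat\pi,\hat\kappa)$ be, almost surely, a maximizer of $\prod_{i=1}^mL_i$ over $\mathfrak P_c$. Then, as $m\to\infty$, $$P(\hat{\mathcal D}=\mathcal D^*)\to1,$$ and there are (data-dependent) permutations $\rho$ of the class labels such that for every $\delta>0$ $$P\Big(\hat{\mathcal D}=\mathcal D^*,\ |\hat\kappa-\kappa^*|<\delta,\ \|(\hat\lambda_{\rho(j)})_j-(\lambda^*_j)_j\|_2<\delta,\ \|(\hat\theta_{\rho(j)w})_{j,w}-(\theta^*_{jw})_{j,w}\|_2<\delta,\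 \|(\hat\pi_{\rho(j)})_j-(\pi^*_j)_j\|_2<\delta\Big)\to1 .$$ -/

import Mathlib

open MeasureTheory ProbabilityTheory Filter Topology
open scoped ENNReal BigOperators

noncomputable section

namespace LTDM

/-! ### Dictionaries, separations and parameters

`𝓔` is the set of event types.  A pattern is a list of events; an `l`-gram is a pattern of
length `l`.  A dictionary is a finite set of patterns. -/

/-- An admissible dictionary: patterns have length at least one and, for patterns of length at
least two, the events in the pattern are distinct (Assumption A2). -/
def IsDictionary {𝓔 : Type*} (D : Finset (List 𝓔)) : Prop :=
  ∀ w ∈ D, w ≠ [] ∧ (2 ≤ w.length → w.Nodup)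

/-- A separation over `D`: an ordered sequence of patterns of `D`, each of which is used at most
once. -/
abbrev Separation {𝓔 : Type*} (D : Finset (List 𝓔)) : Type _ :=
  {S : List {w // w ∈ D} // S.Nodup}

/-- The event sentence obtained by writing the patterns of a separation one after the other. -/
def Separation.sentence {𝓔 : Type*} {D : Finset (List 𝓔)} (S : Separation D) : List 𝓔 :=
  (S.1.map Subtype.val).flatten

open Classical in
/-- `𝓕(E)`: the set of all separations of the sentence `E` over the dictionary `D`. -/
def separations {𝓔 : Type*} (D : Finset (List 𝓔)) (E : List 𝓔) : Finset (Separation D) :=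
  Finset.univ.filter fun S => S.sentence = E

/-- Parameter vectors `(θ, λ, π, κ)` of a model with `J` classes and dictionary `D`, with the
topology of a finite-dimensional real vector space. -/
abbrev Param {𝓔 : Type*} (J : ℕ) (D : Finset (List 𝓔)) : Type _ :=
  (Fin J → {w // w ∈ D} → ℝ) × (Fin J → ℝ) × (Fin J → ℝ) × ℝ

namespace Param

variable {𝓔 : Type*} {J : ℕ} {D : Finset (List 𝓔)}

/-- The pattern probabilities `θ_{jw}`. -/
def theta (p : Param J D) : Fin J → {w // w ∈ D} → ℝ := p.1

/-- The intensities `λ_j`. -/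
def lam (p : Param J D) : Fin J → ℝ := p.2.1

/-- The class probabilities `π_j`. -/
def prob (p : Param J D) : Fin J → ℝ := p.2.2.1

/-- The Poisson parameter `κ`. -/
def kappa (p : Param J D) : ℝ := p.2.2.2

open Classical in
/-- `θ_{jw}` as a function of all patterns, equal to `0` for patterns outside the dictionary. -/
def thetaExt (p : Param J D) (j : Fin J) (w : List 𝓔) : ℝ :=
  if h : w ∈ D then p.theta j ⟨w, h⟩ else 0

end Param

/-- The parameter space over `D`: `θ_{jw} ∈ [0,1]`, `λ_j > 0`, `π_j > 0` with sum one, `κ > 0`. -/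
def paramSpace {𝓔 : Type*} (J : ℕ) (D : Finset (List 𝓔)) : Set (Param J D) :=
  {p | (∀ j w, 0 ≤ p.theta j w ∧ p.theta j w ≤ 1) ∧ (∀ j, 0 < p.lam j) ∧
    (∀ j, 0 < p.prob j) ∧ ∑ j, p.prob j = 1 ∧ 0 < p.kappa}

/-! ### The probability model -/

open Classical in
/-- `P(S | z) = (1 / n_S!) ∏_w θ_{zw}^{1{w ∈ S}} (1 - θ_{zw})^{1{w ∉ S}}`. -/
def sepProb {𝓔 : Type*} {J : ℕ} {D : Finset (List 𝓔)} (p : Param J D) (z : Fin J)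
    (S : Separation D) : ℝ :=
  1 / (S.1.length.factorial : ℝ) *
    ∏ w : {w // w ∈ D}, if w ∈ S.1 then p.theta z w else 1 - p.theta z w

/-- An observed sentence: the event sentence `E` and its gap times. -/
abbrev SentenceObs (𝓔 : Type*) : Type _ := Σ E : List 𝓔, (Fin E.length → ℝ)

/-- The observation of one examinee: the number `K` of sentences, and the `K` sentences. -/
abbrev Obs (𝓔 : Type*) : Type _ := Σ K : ℕ, (Fin K → SentenceObs 𝓔)

/-- The law of a sentence and its gap times given the class `z`: a separation `S` is drawn with
probability `P(S | z)`, its sentence is observed, and the gap times are independent exponential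
variables with rate `λ_z`. -/
def sentenceLaw {𝓔 : Type*} {J : ℕ} {D : Finset (List 𝓔)} (p : Param J D) (z : Fin J) :
    Measure (SentenceObs 𝓔) :=
  ∑ S : Separation D, ENNReal.ofReal (sepProb p z S) •
    Measure.map (fun t : Fin S.sentence.length → ℝ => (⟨S.sentence, t⟩ : SentenceObs 𝓔))
      (Measure.pi fun _ => expMeasure (p.lam z))

/-- The law of the observation of one examinee: `K` is Poisson with parameter `κ`, the class `z` has
law `π` and is independent of `K`, and given `K` and `z` the `K` sentences are independent with law
`sentenceLaw p z`. -/
def law {𝓔 : Type*} {J : ℕ} {D : Finset (List 𝓔)} (p : Param J D) : Measure (Obs 𝓔) :=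
  Measure.sum fun K : ℕ =>
    ENNReal.ofReal (p.kappa ^ K * Real.exp (-p.kappa) / (K.factorial : ℝ)) •
      Measure.map (fun s : Fin K → SentenceObs 𝓔 => (⟨K, s⟩ : Obs 𝓔))
        (∑ z : Fin J, ENNReal.ofReal (p.prob z) • Measure.pi fun _ => sentenceLaw p z)

/-- `P(E, T̃ | z)`, the likelihood of one sentence in class `z`. -/
def sentenceLik {𝓔 : Type*} {J : ℕ} {D : Finset (List 𝓔)} (p : Param J D) (z : Fin J)
    (s : SentenceObs 𝓔) : ℝ :=
  (∑ S ∈ separations D s.1, sepProb p z S) *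
    ∏ u, p.lam z * Real.exp (-(p.lam z * s.2 u))

/-- The likelihood `L` of the observation of one examinee. -/
def lik {𝓔 : Type*} {J : ℕ} {D : Finset (List 𝓔)} (p : Param J D) (x : Obs 𝓔) : ℝ :=
  p.kappa ^ x.1 * Real.exp (-p.kappa) / (x.1.factorial : ℝ) *
    ∑ z, p.prob z * ∏ k, sentenceLik p z (x.2 k)

/-! ### Assumption A1 and Conditions C1, C2 -/

/-- `𝓞_j`: the sentences generated by the patterns `w` with `θ_{jw} ≠ 0`. -/
def classSentences {𝓔 : Type*} {J : ℕ} {D : Finset (List 𝓔)} (p : Param J D) (j : Fin J) :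
    Set (List 𝓔) :=
  {E | ∃ S : Separation D, (∀ w ∈ S.1, p.theta j w ≠ 0) ∧ S.sentence = E}

open Classical in
/-- The equivalence class `[j]`: the classes with the same intensity as `j`. -/
def eqClass {𝓔 : Type*} {J : ℕ} {D : Finset (List 𝓔)} (p : Param J D) (j : Fin J) :
    Finset (Fin J) :=
  Finset.univ.filter fun i => p.lam i = p.lam j

/-- `𝓞_{[j]}`: the sentences that are generated by some class of the equivalence class `[j]`. -/
def eqClassSentences {𝓔 : Type*} {J : ℕ} {D : Finset (List 𝓔)} (p : Param J D) (j : Fin J) :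
    Set (List 𝓔) :=
  {E | ∃ i ∈ eqClass p j, E ∈ classSentences p i}

/-- Assumption A1: if `E ∈ 𝓞_{[j]}` contains (as consecutive events) a subsentence `E₁ ∈ 𝓞_j` that
avoids `e` and has the length of the longest sentences of `𝓞_j` that avoid `e`, then `E ∈ 𝓞_j`. -/
def AssumptionA1 {𝓔 : Type*} {J : ℕ} {D : Finset (List 𝓔)} (p : Param J D) : Prop :=
  ∀ (j : Fin J) (e : 𝓔) (E E₁ : List 𝓔), E ∈ eqClassSentences p j → E₁ <:+: E →
    E₁ ∈ classSentences p j → e ∉ E₁ →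
    (∀ E₂ ∈ classSentences p j, e ∉ E₂ → E₂.length ≤ E₁.length) → E ∈ classSentences p j

/-- The `T`-matrix with rows indexed by a set `I` of 1-grams (written as events), columns indexed by
the classes in `[j]` and entries `θ_{j₁e} / (1 - θ_{j₁e})`. -/
def tMatrix {𝓔 : Type*} {J : ℕ} {D : Finset (List 𝓔)} (p : Param J D) (j : Fin J)
    (I : Finset 𝓔) : Matrix {e // e ∈ I} {i // i ∈ eqClass p j} ℝ :=
  Matrix.of fun e i => p.thetaExt i.1 [e.1] / (1 - p.thetaExt i.1 [e.1])

/-- Full column rank: the columns are linearly independent. -/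
def FullColumnRank {m n : Type*} (A : Matrix m n ℝ) : Prop :=
  LinearIndependent ℝ fun j : n => fun i : m => A i j

/-- Condition C1: for each equivalence class `[j]` with more than one element the 1-grams of `D` are
partitioned into three sets with at least `|[j]|` elements each, such that sentences of two or three
1-grams from different parts have only one separation, and such that the three `T`-matrices have
full column rank. -/
def ConditionC1 {𝓔 : Type*} {J : ℕ} {D : Finset (List 𝓔)} (p : Param J D) : Prop :=
  ∀ j : Fin J, 1 < (eqClass p j).card →
    ∃ I : Fin 3 → Finset 𝓔,
      (∀ k l, k ≠ l → Disjoint (I k) (I l)) ∧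
      (∀ e, [e] ∈ D ↔ ∃ k, e ∈ I k) ∧
      (∀ k l, k ≠ l → ∀ e ∈ I k, ∀ f ∈ I l, (separations D [e, f]).card = 1) ∧
      (∀ e₁ ∈ I 0, ∀ e₂ ∈ I 1, ∀ e₃ ∈ I 2, (separations D [e₁, e₂, e₃]).card = 1) ∧
      (∀ k, (eqClass p j).card ≤ (I k).card) ∧
      ∀ k, FullColumnRank (tMatrix p j (I k))

/-- Condition C2: for each equivalence class `[j]` with more than one element and each `l`-gram
`w ∈ D` with `l ≥ 2` there is a set `I` of at least `|[j]|` 1-grams of `D` such that, for `e ∈ I`, no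
separation of the sentence `(w, e)` other than `w` followed by `[e]` contains an `(l+1)`-gram or an
`l`-gram other than `w`, and such that the `T`-matrix of `I` has full column rank. -/
def ConditionC2 {𝓔 : Type*} {J : ℕ} {D : Finset (List 𝓔)} (p : Param J D) : Prop :=
  ∀ j : Fin J, 1 < (eqClass p j).card → ∀ w ∈ D, 2 ≤ w.length →
    ∃ I : Finset 𝓔,
      (∀ e ∈ I, [e] ∈ D) ∧
      (∀ e ∈ I, ∀ S ∈ separations D (w ++ [e]), S.1.map Subtype.val ≠ [w, [e]] →
        ∀ v ∈ S.1, v.1.length ≠ w.length + 1 ∧ (v.1.length = w.length → v.1 = w)) ∧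
      (eqClass p j).card ≤ I.card ∧
      FullColumnRank (tMatrix p j I)

/-! ### Maximum likelihood estimation -/

/-- A candidate model: a dictionary together with a parameter vector. -/
abbrev Model (𝓔 : Type*) (J : ℕ) : Type _ := Σ D : Finset (List 𝓔), Param J D

/-- All models whose dictionary is admissible and has at most `v` patterns and whose parameter
vector lies in the prescribed set `Θ D` of parameters over that dictionary. -/
def candidates {𝓔 : Type*} {J : ℕ} (v : ℕ) (Θ : ∀ D : Finset (List 𝓔), Set (Param J D)) :
    Set (Model 𝓔 J) :=
  {c | IsDictionary c.1 ∧ c.1.card ≤ v ∧ c.2 ∈ Θ c.1}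

/-- `c` is a maximum likelihood estimate over `P` for the observations `x` of `m` examinees. -/
def IsMLE {𝓔 : Type*} {J : ℕ} (P : Set (Model 𝓔 J)) {m : ℕ} (x : Fin m → Obs 𝓔)
    (c : Model 𝓔 J) : Prop :=
  c ∈ P ∧ ∀ c' ∈ P, ∏ i, lik c'.2 (x i) ≤ ∏ i, lik c.2 (x i)

/-- After relabelling the classes of `c` by `ρ`, every component of the parameter vector of `c` is
within `δ` of the one of the model `(D, p)` in Euclidean norm. -/
def Close {𝓔 : Type*} {J : ℕ} {D : Finset (List 𝓔)} (p : Param J D) (c : Model 𝓔 J)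
    (ρ : Equiv.Perm (Fin J)) (δ : ℝ) : Prop :=
  |c.2.kappa - p.kappa| < δ ∧
  Real.sqrt (∑ j, (c.2.lam (ρ j) - p.lam j) ^ 2) < δ ∧
  Real.sqrt (∑ j, ∑ w ∈ D, (c.2.thetaExt (ρ j) w - p.thetaExt j w) ^ 2) < δ ∧
  Real.sqrt (∑ j, (c.2.prob (ρ j) - p.prob j) ^ 2) < δ

/-- The events `A m` have probability tending to one.  The statement is about the complements, so
that it is meaningful (through the outer measure) for maximizers that are not chosen measurably. -/
def ProbTendsToOne {Ω : Type*} [MeasurableSpace Ω] (μ : Measure Ω) (A : ℕ → Set Ω) : Prop :=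
  Tendsto (fun m => μ (A m)ᶜ) atTop (𝓝 0)

end LTDM

end

noncomputable section

namespace LTDM

/-! ### Products of densities and measures on disjoint unions -/

lemma lintegral_pi_fin_prod {α : Type*} [MeasurableSpace α] (μ : Measure α) [SigmaFinite μ] :
    ∀ (n : ℕ) (f : Fin n → α → ℝ≥0∞), (∀ i, Measurable (f i)) →
      ∫⁻ x, ∏ i, f i (x i) ∂(Measure.pi fun _ : Fin n => μ) = ∏ i, ∫⁻ a, f i a ∂μ := by
  intro n
  induction n with
  | zero => intro f _; simp
  | succ n ih =>
    intro f hf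
    have h := (measurePreserving_piFinSuccAbove (fun _ : Fin (n + 1) => μ) 0)
    have hm : Measurable fun y : α × (Fin n → α) => f 0 y.1 * ∏ i : Fin n, f i.succ (y.2 i) := by
      have := hf 0
      have h2 : ∀ i : Fin n, Measurable (f i.succ) := fun i => hf _
      fun_prop
    have e : ∀ x : Fin (n + 1) → α, ∏ i, f i (x i) =
        (fun y : α × (Fin n → α) => f 0 y.1 * ∏ i : Fin n, f i.succ (y.2 i))
          (MeasurableEquiv.piFinSuccAbove (fun _ : Fin (n + 1) => α) 0 x) := by
      intro x
      rw [Fin.prod_univ_succ]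
      rfl
    have hm2 : Measurable fun y : Fin n → α => ∏ i : Fin n, f i.succ (y i) :=
      Finset.measurable_prod _ fun i _ => (hf _).comp (measurable_pi_apply i)
    rw [lintegral_congr e, h.lintegral_comp hm, Fin.prod_univ_succ, ← ih _ fun i => hf _]
    exact lintegral_prod_mul (hf 0).aemeasurable hm2.aemeasurable

lemma pi_withDensity_fin {α : Type*} [MeasurableSpace α] (μ : Measure α) [SigmaFinite μ]
    (n : ℕ) (f : α → ℝ≥0∞) (hf : Measurable f) [SigmaFinite (μ.withDensity f)] :
    Measure.pi (fun _ : Fin n => μ.withDensity f) =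
      (Measure.pi fun _ : Fin n => μ).withDensity fun x => ∏ i, f (x i) := by
  refine Measure.pi_eq fun s hs => ?_
  rw [withDensity_apply _ (MeasurableSet.univ_pi hs),
    ← lintegral_indicator (MeasurableSet.univ_pi hs)]
  have e : ∀ x : Fin n → α, (Set.univ.pi s).indicator (fun x => ∏ i, f (x i)) x =
      ∏ i, (s i).indicator f (x i) := by
    intro x
    by_cases hx : x ∈ Set.univ.pi s
    · rw [Set.indicator_of_mem hx]
      exact Finset.prod_congr rfl fun i _ => (Set.indicator_of_mem (hx i trivial) _).symm
    · rw [Set.indicator_of_notMem hx]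
      simp only [Set.mem_pi, Set.mem_univ, true_implies, not_forall] at hx
      obtain ⟨i, hi⟩ := hx
      exact (Finset.prod_eq_zero (Finset.mem_univ i) (Set.indicator_of_notMem hi _)).symm
  rw [lintegral_congr e, lintegral_pi_fin_prod μ n _ fun i => hf.indicator (hs i)]
  refine Finset.prod_congr rfl fun i _ => ?_
  rw [lintegral_indicator (hs i), withDensity_apply _ (hs i)]

section Sigma

variable {ι : Type*} {β : ι → Type*} [∀ i, MeasurableSpace (β i)]

lemma measurableSet_sigma {s : Set (Sigma β)} :
    MeasurableSet s ↔ ∀ i, MeasurableSet (Sigma.mk i ⁻¹' s) := by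
  simp only [MeasurableSpace.measurableSet_iInf]
  rfl

lemma measurable_sigmaMk (i : ι) : Measurable (Sigma.mk i : β i → Sigma β) :=
  fun _ hs => measurableSet_sigma.1 hs i

lemma measurable_sigma_of {γ : Type*} [MeasurableSpace γ] {f : Sigma β → γ}
    (h : ∀ i, Measurable fun b => f ⟨i, b⟩) : Measurable f :=
  fun _ hs => measurableSet_sigma.2 fun i => h i hs

lemma measurableSet_sigma_image (i : ι) {s : Set (β i)} (hs : MeasurableSet s) :
    MeasurableSet (Sigma.mk i '' s) := by
  refine measurableSet_sigma.2 fun j => ?_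
  by_cases h : i = j
  · subst h
    rwa [Set.preimage_image_eq _ sigma_mk_injective]
  · rw [Set.preimage_image_sigmaMk_of_ne fun h' => h h'.symm]
    exact MeasurableSet.empty

/-- The measure on a disjoint union whose restriction to the `i`-th part is `μ i`. -/
def sigmaMeasure (μ : ∀ i, Measure (β i)) : Measure (Sigma β) :=
  Measure.sum fun i => (μ i).map (Sigma.mk i)

lemma lintegral_sigmaMeasure (μ : ∀ i, Measure (β i)) {f : Sigma β → ℝ≥0∞} (hf : Measurable f) :
    ∫⁻ x, f x ∂(sigmaMeasure μ) = ∑' i, ∫⁻ b, f ⟨i, b⟩ ∂(μ i) := by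
  rw [sigmaMeasure, lintegral_sum_measure]
  exact tsum_congr fun i => lintegral_map hf (measurable_sigmaMk i)

lemma sigmaMeasure_apply (μ : ∀ i, Measure (β i)) {s : Set (Sigma β)} (hs : MeasurableSet s) :
    sigmaMeasure μ s = ∑' i, μ i (Sigma.mk i ⁻¹' s) := by
  rw [sigmaMeasure, Measure.sum_apply _ hs]
  exact tsum_congr fun i => Measure.map_apply (measurable_sigmaMk i) hs

lemma sigmaMeasure_image (μ : ∀ i, Measure (β i)) (i : ι) {s : Set (β i)} (hs : MeasurableSet s) :
    sigmaMeasure μ (Sigma.mk i '' s) = μ i s := by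
  rw [sigmaMeasure_apply μ (measurableSet_sigma_image i hs), tsum_eq_single i]
  · rw [Set.preimage_image_eq _ sigma_mk_injective]
  · intro j hj
    rw [Set.preimage_image_sigmaMk_of_ne hj, measure_empty]

lemma sigmaMeasure_withDensity (μ : ∀ i, Measure (β i)) {f : Sigma β → ℝ≥0∞}
    (hf : Measurable f) :
    (sigmaMeasure μ).withDensity f =
      sigmaMeasure fun i => (μ i).withDensity fun b => f ⟨i, b⟩ := by
  have hfi : ∀ i, Measurable fun b => f ⟨i, b⟩ := fun i => hf.comp (measurable_sigmaMk i)
  refine Measure.ext_of_lintegral _ fun g hg => ?_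
  have hgi : ∀ i, Measurable fun b => g ⟨i, b⟩ := fun i => hg.comp (measurable_sigmaMk i)
  rw [lintegral_withDensity_eq_lintegral_mul _ hf hg, lintegral_sigmaMeasure _ (hf.mul hg),
    lintegral_sigmaMeasure _ hg]
  exact tsum_congr fun i => (lintegral_withDensity_eq_lintegral_mul _ (hfi i) (hgi i)).symm

instance sigmaMeasure_sigmaFinite [Countable ι] (μ : ∀ i, Measure (β i))
    [∀ i, SigmaFinite (μ i)] : SigmaFinite (sigmaMeasure μ) := by
  refine Measure.sigmaFinite_of_countable
    (S := Set.range fun q : ι × ℕ => Sigma.mk q.1 '' spanningSets (μ q.1) q.2)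
    (Set.countable_range _) ?_ ?_
  · rintro _ ⟨q, rfl⟩
    simp only
    rw [sigmaMeasure_image _ _ (measurableSet_spanningSets _ _)]
    exact measure_spanningSets_lt_top _ _
  · refine Set.eq_univ_of_forall fun x => ?_
    obtain ⟨n, hn⟩ : ∃ n, x.2 ∈ spanningSets (μ x.1) n :=
      Set.mem_iUnion.1 ((iUnion_spanningSets (μ x.1)).symm ▸ Set.mem_univ _)
    exact ⟨_, ⟨(x.1, n), rfl⟩, x.2, hn, rfl⟩

end Sigma

/-! ### Consistency from strict inequality of the Hellinger affinity -/

lemma lintegral_rpow_half_mul_lt_one {𝓧 : Type*} [MeasurableSpace 𝓧] {ν : Measure 𝓧}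
    {f g : 𝓧 → ℝ≥0∞} (hf : Measurable f) (hg : Measurable g) (hft : ∀ x, f x ≠ ∞)
    (hgt : ∀ x, g x ≠ ∞) (hf1 : ∫⁻ x, f x ∂ν ≤ 1) (hg1 : ∫⁻ x, g x ∂ν ≤ 1)
    (hne : ¬ f =ᵐ[ν] g) : ∫⁻ x, (f x * g x) ^ (1 / 2 : ℝ) ∂ν < 1 := by
  by_contra! hge
  have key : ∀ a b : ℝ≥0∞, a ≠ ∞ → b ≠ ∞ → (a * b) ^ (1 / 2 : ℝ) ≤ (a + b) / 2 ∧
      ((a * b) ^ (1 / 2 : ℝ) = (a + b) / 2 → a = b) := by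
    intro a b ha hb
    lift a to NNReal using ha
    lift b to NNReal using hb
    rw [← ENNReal.coe_mul, ← ENNReal.coe_rpow_of_nonneg _ (by norm_num), ← NNReal.sqrt_eq_rpow,
      ← ENNReal.coe_add, show (2 : ℝ≥0∞) = ((2 : NNReal) : ℝ≥0∞) from rfl,
      ← ENNReal.coe_div (by norm_num), ENNReal.coe_le_coe, ENNReal.coe_inj, ENNReal.coe_inj]
    rw [← NNReal.coe_le_coe, ← NNReal.coe_inj, ← NNReal.coe_inj]
    push_cast
    constructor
    · rw [Real.sqrt_le_left (by positivity)]
      nlinarith [sq_nonneg ((a : ℝ) - b)]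
    · intro h
      have h2 : (a : ℝ) * b = ((a + b) / 2) ^ 2 := by
        rw [← h, Real.sq_sqrt (by positivity)]
      nlinarith [sq_nonneg ((a : ℝ) - b), sq_eq_zero_iff.1 (show ((a : ℝ) - b) ^ 2 = 0 by nlinarith)]
  have hm : Measurable fun x => (f x * g x) ^ (1 / 2 : ℝ) := by fun_prop
  have hsum : ∫⁻ x, (f x + g x) / 2 ∂ν ≤ 1 := by
    simp_rw [div_eq_mul_inv]
    rw [lintegral_mul_const _ (by fun_prop), lintegral_add_left hf, ← div_eq_mul_inv]
    refine ENNReal.div_le_of_le_mul ?_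
    calc _ ≤ (1 : ℝ≥0∞) + 1 := add_le_add hf1 hg1
      _ = 1 * 2 := by norm_num
  have hle : ∀ x, (f x * g x) ^ (1 / 2 : ℝ) ≤ (f x + g x) / 2 :=
    fun x => (key _ _ (hft x) (hgt x)).1
  have hfin : ∫⁻ x, (f x * g x) ^ (1 / 2 : ℝ) ∂ν ≠ ∞ :=
    ((lintegral_mono hle).trans hsum).trans_lt ENNReal.one_lt_top |>.ne
  have hae := ae_eq_of_ae_le_of_lintegral_le (Eventually.of_forall hle) hfin
    (by fun_prop) (hsum.trans hge)
  refine hne ?_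
  filter_upwards [hae] with x hx
  exact (key _ _ (hft x) (hgt x)).2 hx

/-- A uniform exponential bound: if the observations have density `g` and `F` has Hellinger
affinity `r` with `g`, then `∏ g ≤ ∏ F` has probability at most `r ^ m`. -/
lemma measure_prod_le_prod_le {𝓧 Ω : Type*} [MeasurableSpace 𝓧] [MeasurableSpace Ω]
    {ν : Measure 𝓧} {μ : Measure Ω} [IsProbabilityMeasure μ] {F g : 𝓧 → ℝ≥0∞}
    (hF : Measurable F) (hg : Measurable g) (hgt : ∀ x, g x ≠ ∞) {X : ℕ → Ω → 𝓧}
    (hXm : ∀ i, Measurable (X i)) (hXind : iIndepFun X μ)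
    (hXlaw : ∀ i, μ.map (X i) = ν.withDensity g) (m : ℕ) :
    μ {ω | ∏ i : Fin m, g (X i ω) ≤ ∏ i : Fin m, F (X i ω)} ≤
      (∫⁻ x, (F x * g x) ^ (1 / 2 : ℝ) ∂ν) ^ m := by
  set Y : ℕ → Ω → ℝ≥0∞ := fun i ω => (F (X i ω) / g (X i ω)) ^ (1 / 2 : ℝ) with hY
  have hYm : ∀ i, Measurable (Y i) := fun i =>
    ((hF.comp (hXm i)).div (hg.comp (hXm i))).pow_const _
  have hpos : ∀ᵐ ω ∂μ, ∀ i, g (X i ω) ≠ 0 := by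
    rw [ae_all_iff]
    intro i
    have h : ∀ᵐ x ∂(μ.map (X i)), g x ≠ 0 := by
      rw [hXlaw i, ae_withDensity_iff hg]
      exact Eventually.of_forall fun x hx => hx
    exact ae_of_ae_map (hXm i).aemeasurable h
  have hint : ∀ i, ∫⁻ ω, Y i ω ∂μ = ∫⁻ x, (F x * g x) ^ (1 / 2 : ℝ) ∂ν := by
    intro i
    have hFg : Measurable fun x => (F x / g x) ^ (1 / 2 : ℝ) := (hF.div hg).pow_const _
    have h1 : ∫⁻ ω, Y i ω ∂μ = ∫⁻ x, (F x / g x) ^ (1 / 2 : ℝ) ∂(μ.map (X i)) :=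
      (lintegral_map hFg (hXm i)).symm
    rw [h1, hXlaw i, lintegral_withDensity_eq_lintegral_mul _ hg hFg]
    refine lintegral_congr fun x => ?_
    simp only [Pi.mul_apply]
    by_cases h0 : g x = 0
    · simp [h0]
    · have hsq : g x * (F x / g x) ^ (1 / 2 : ℝ) =
          (g x ^ (2 : ℝ)) ^ (1 / 2 : ℝ) * (F x / g x) ^ (1 / 2 : ℝ) := by
        rw [← ENNReal.rpow_mul]; norm_num
      rw [hsq, ← ENNReal.mul_rpow_of_nonneg _ _ (by norm_num : (0 : ℝ) ≤ 1 / 2)]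
      congr 1
      rw [ENNReal.rpow_two, sq, mul_assoc, mul_comm, ENNReal.mul_div_cancel h0 (hgt x)]
  have hmono : ∀ᵐ ω ∂μ, ω ∈ {ω | ∏ i : Fin m, g (X i ω) ≤ ∏ i : Fin m, F (X i ω)} →
      ω ∈ {ω | (1 : ℝ≥0∞) ≤ ∏ i : Fin m, Y i ω} := by
    filter_upwards [hpos] with ω hω h
    change ∏ i : Fin m, g (X i ω) ≤ ∏ i : Fin m, F (X i ω) at h
    have hG0 : ∏ i : Fin m, g (X i ω) ≠ 0 := Finset.prod_ne_zero_iff.2 fun i _ => hω i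
    have hGt : ∏ i : Fin m, g (X i ω) ≠ ∞ := ENNReal.prod_ne_top fun i _ => hgt _
    have e : ∏ i : Fin m, Y i ω =
        ((∏ i : Fin m, F (X i ω)) / ∏ i : Fin m, g (X i ω)) ^ (1 / 2 : ℝ) := by
      simp only [hY]
      rw [ENNReal.prod_rpow_of_nonneg (by norm_num : (0 : ℝ) ≤ 1 / 2)]
      congr 1
      simp only [div_eq_mul_inv]
      rw [Finset.prod_mul_distrib, ENNReal.prod_inv_distrib]
      intro i _ j _ _
      exact Or.inl (hω i)
    rw [e]
    refine ENNReal.one_le_rpow ?_ (by norm_num)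
    rwa [ENNReal.le_div_iff_mul_le (Or.inl hG0) (Or.inl hGt), one_mul]
  have hindY : iIndepFun (fun i : Fin m => Y i) μ :=
    (hXind.comp (fun _ x => (F x / g x) ^ (1 / 2 : ℝ)) fun _ => (hF.div hg).pow_const _).precomp
      Fin.val_injective
  calc μ {ω | ∏ i : Fin m, g (X i ω) ≤ ∏ i : Fin m, F (X i ω)}
      ≤ μ {ω | (1 : ℝ≥0∞) ≤ ∏ i : Fin m, Y i ω} := measure_mono_ae hmono
    _ ≤ (∫⁻ ω, ∏ i : Fin m, Y i ω ∂μ) / 1 :=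
        meas_ge_le_lintegral_div
          (Finset.measurable_prod Finset.univ fun (i : Fin m) _ => hYm i).aemeasurable
          one_ne_zero ENNReal.one_ne_top
    _ = ∏ i : Fin m, ∫⁻ ω, Y i ω ∂μ := by
        rw [div_one]
        exact lintegral_prod_eq_prod_lintegral_of_indepFun Finset.univ (fun i : Fin m => Y i)
          hindY fun i => hYm i
    _ = _ := by simp [hint]

lemma measure_exists_prod_le_tendsto_zero {𝓧 Ω T : Type*} [MeasurableSpace 𝓧] [MeasurableSpace Ω]
    [PseudoMetricSpace T] [SecondCountableTopology T]
    {ν : Measure 𝓧} {μ : Measure Ω} [IsProbabilityMeasure μ] {f : T → 𝓧 → ℝ≥0∞} {g G : 𝓧 → ℝ≥0∞}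
    (hf : ∀ t, Measurable (f t)) (hfc : ∀ x, Continuous fun t => f t x)
    (hft : ∀ t x, f t x ≠ ∞) (hg : Measurable g) (hgt : ∀ x, g x ≠ ∞)
    (hg1 : ∫⁻ x, g x ∂ν ≤ 1) {K : Set T} (hK : IsCompact K) (hf1 : ∀ t ∈ K, ∫⁻ x, f t x ∂ν ≤ 1)
    (hG : ∫⁻ x, G x ∂ν ≠ ∞) (hfG : ∀ t ∈ K, ∀ x, f t x ≤ G x) (hne : ∀ t ∈ K, ¬ f t =ᵐ[ν] g)
    {X : ℕ → Ω → 𝓧} (hXm : ∀ i, Measurable (X i)) (hXind : iIndepFun X μ)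
    (hXlaw : ∀ i, μ.map (X i) = ν.withDensity g) :
    Tendsto (fun m : ℕ => μ {ω | ∃ t ∈ K, ∏ i : Fin m, g (X i ω) ≤ ∏ i : Fin m, f t (X i ω)})
      atTop (𝓝 0) := by
  have hloc : ∀ t ∈ K, ∃ U ∈ 𝓝[K] t, Tendsto (fun m : ℕ => μ {ω | ∃ s ∈ U,
      ∏ i : Fin m, g (X i ω) ≤ ∏ i : Fin m, f s (X i ω)}) atTop (𝓝 0) := by
    intro t ht
    set B : ℕ → Set T := fun n => K ∩ Metric.ball t (1 / ((n : ℝ) + 1)) with hB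
    have hdense : ∀ n, ∃ C : Set T, C ⊆ B n ∧ C.Countable ∧ B n ⊆ closure C := fun n =>
      (TopologicalSpace.IsSeparable.of_separableSpace (B n)).exists_countable_dense_subset
    choose C hCB hCc hCd using hdense
    set F : ℕ → 𝓧 → ℝ≥0∞ := fun n x => ⨆ s ∈ C n, f s x with hF
    have hFm : ∀ n, Measurable (F n) := fun n => Measurable.biSup _ (hCc n) fun s _ => hf s
    have hBF : ∀ n, ∀ s ∈ B n, ∀ x, f s x ≤ F n x := by
      intro n s hs x
      have hcl : IsClosed {s | f s x ≤ F n x} := isClosed_le (hfc x) continuous_const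
      exact hcl.closure_subset_iff.2 (fun r hr => le_iSup₂ (f := fun s _ => f s x) r hr) (hCd n hs)
    have hFG : ∀ n x, F n x ≤ G x := fun n x => iSup₂_le fun s hs => hfG s (hCB n hs).1 x
    have htB : ∀ n, t ∈ B n := fun n => ⟨ht, Metric.mem_ball_self (by positivity)⟩
    have hFlim : ∀ x, Tendsto (fun n => F n x) atTop (𝓝 (f t x)) := by
      intro x
      refine tendsto_order.2 ⟨fun a ha => Eventually.of_forall fun n =>
        ha.trans_le (hBF n t (htB n) x), fun a ha => ?_⟩
      obtain ⟨b, hb1, hb2⟩ := exists_between ha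
      have hnear : ∀ᶠ s in 𝓝 t, f s x < b := (hfc x).continuousAt.eventually (gt_mem_nhds hb1)
      obtain ⟨ε, hε, hball⟩ := Metric.mem_nhds_iff.1 hnear
      obtain ⟨N, hN⟩ := exists_nat_one_div_lt hε
      filter_upwards [eventually_ge_atTop N] with n hn
      refine lt_of_le_of_lt (iSup₂_le fun s hs => ?_) hb2
      refine le_of_lt (hball (Metric.ball_subset_ball ?_ (hCB n hs).2))
      exact (one_div_le_one_div_of_le (by positivity) (by gcongr)).trans hN.le
    have hlim : Tendsto (fun n => ∫⁻ x, (F n x * g x) ^ (1 / 2 : ℝ) ∂ν) atTop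
        (𝓝 (∫⁻ x, (f t x * g x) ^ (1 / 2 : ℝ) ∂ν)) := by
      refine tendsto_lintegral_of_dominated_convergence (fun x => G x + g x)
        (fun n => ((hFm n).mul hg).pow_const _) (fun n => Eventually.of_forall fun x => ?_) ?_
        (Eventually.of_forall fun x => ?_)
      · calc (F n x * g x) ^ (1 / 2 : ℝ) ≤ ((G x + g x) ^ (2 : ℝ)) ^ (1 / 2 : ℝ) := by
              refine ENNReal.rpow_le_rpow ?_ (by norm_num)
              rw [ENNReal.rpow_two, sq]
              exact mul_le_mul' ((hFG n x).trans le_self_add) le_add_self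
          _ = G x + g x := by rw [← ENNReal.rpow_mul]; norm_num
      · rw [lintegral_add_right _ hg]
        exact ENNReal.add_ne_top.2 ⟨hG, (hg1.trans_lt ENNReal.one_lt_top).ne⟩
      · refine (ENNReal.continuous_rpow_const.tendsto _).comp ?_
        exact ENNReal.Tendsto.mul_const (hFlim x) (Or.inr (hgt x))
    have hlt := lintegral_rpow_half_mul_lt_one (hf t) hg (hft t) hgt (hf1 t ht) hg1 (hne t ht)
    obtain ⟨n, hn⟩ := (hlim.eventually (gt_mem_nhds hlt)).exists
    refine ⟨B n, Filter.inter_mem self_mem_nhdsWithin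
      (mem_nhdsWithin_of_mem_nhds (Metric.ball_mem_nhds t (by positivity))), ?_⟩
    refine tendsto_of_tendsto_of_tendsto_of_le_of_le tendsto_const_nhds
      (ENNReal.tendsto_pow_atTop_nhds_zero_of_lt_one hn) (fun _ => zero_le) fun m => ?_
    refine (measure_mono ?_).trans (measure_prod_le_prod_le (hFm n) hg hgt hXm hXind hXlaw m)
    rintro ω ⟨s, hs, hω⟩
    exact hω.trans (Finset.prod_le_prod' fun i _ => hBF n s hs _)
  choose! U hU hUlim using hloc
  obtain ⟨I, hIK, hIcov⟩ := hK.elim_nhdsWithin_subcover U hU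
  have hsum : Tendsto (fun m : ℕ => ∑ t ∈ I, μ {ω | ∃ s ∈ U t,
      ∏ i : Fin m, g (X i ω) ≤ ∏ i : Fin m, f s (X i ω)}) atTop (𝓝 0) := by
    simpa using tendsto_finsetSum I fun t ht => hUlim t (hIK t ht)
  refine tendsto_of_tendsto_of_tendsto_of_le_of_le tendsto_const_nhds hsum (fun _ => zero_le)
    fun m => ?_
  refine (measure_mono ?_).trans (measure_biUnion_finset_le I _)
  rintro ω ⟨s, hs, hω⟩
  obtain ⟨t, ht, hst⟩ := Set.mem_iUnion₂.1 (hIcov hs)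
  exact Set.mem_iUnion₂.2 ⟨t, ht, s, hst, hω⟩

/-! ### The total mass of the separations -/

open Classical in
lemma sum_nodup_lists {α : Type*} [Fintype α] (F : Finset α → ℝ) :
    ∑ S : {l : List α // l.Nodup}, 1 / (S.1.length.factorial : ℝ) * F S.1.toFinset =
      ∑ A : Finset α, F A := by
  rw [← Finset.sum_fiberwise Finset.univ (fun S : {l : List α // l.Nodup} => S.1.toFinset)]
  refine Finset.sum_congr rfl fun A _ => ?_
  have hlen : ∀ S ∈ Finset.univ.filter fun S : {l : List α // l.Nodup} => S.1.toFinset = A,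
      1 / (S.1.length.factorial : ℝ) * F S.1.toFinset = 1 / (A.card.factorial : ℝ) * F A := by
    intro S hS
    have hA : S.1.toFinset = A := (Finset.mem_filter.1 hS).2
    rw [← hA, List.toFinset_card_of_nodup S.2]
  have hcard : (Finset.univ.filter fun S : {l : List α // l.Nodup} => S.1.toFinset = A).card =
      A.card.factorial := by
    rw [← Finset.length_toList A, ← List.length_permutations,
      ← List.toFinset_card_of_nodup (List.nodup_permutations _ A.nodup_toList)]
    refine Finset.card_bij (fun S _ => S.1) ?_ ?_ ?_
    · intro S hS
      have hA : S.1.toFinset = A := (Finset.mem_filter.1 hS).2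
      rw [List.mem_toFinset, List.mem_permutations]
      refine (List.perm_ext_iff_of_nodup S.2 A.nodup_toList).2 fun a => ?_
      rw [Finset.mem_toList, ← hA, List.mem_toFinset]
    · intro S _ S' _ h
      exact Subtype.ext h
    · intro l hl
      rw [List.mem_toFinset, List.mem_permutations] at hl
      refine ⟨⟨l, hl.nodup_iff.2 A.nodup_toList⟩, ?_, rfl⟩
      rw [Finset.mem_filter]
      refine ⟨Finset.mem_univ _, ?_⟩
      ext a
      rw [List.mem_toFinset, hl.mem_iff, Finset.mem_toList]
  rw [Finset.sum_congr rfl hlen, Finset.sum_const, hcard, nsmul_eq_mul, ← mul_assoc,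
    mul_one_div_cancel (by positivity), one_mul]

section

variable {𝓔 : Type*} {J : ℕ} {D : Finset (List 𝓔)}

lemma sum_sepProb (p : Param J D) (z : Fin J) : ∑ S, sepProb p z S = 1 := by
  classical
  have h := sum_nodup_lists (α := {w // w ∈ D})
    fun A => ∏ w, if w ∈ A then p.theta z w else 1 - p.theta z w
  have h2 : ∑ S, sepProb p z S = ∑ A : Finset {w // w ∈ D},
      ∏ w, if w ∈ A then p.theta z w else 1 - p.theta z w := by
    rw [← h]
    refine Finset.sum_congr rfl fun S _ => ?_
    simp only [sepProb, List.mem_toFinset]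
  rw [h2]
  have h3 := Finset.prod_add (fun w => p.theta z w) (fun w => 1 - p.theta z w) Finset.univ
  simp only [add_sub_cancel, Finset.prod_const_one, Finset.powerset_univ] at h3
  refine Eq.trans (Finset.sum_congr rfl fun A _ => ?_) h3.symm
  rw [Finset.prod_ite]
  congr 1
  · exact Finset.prod_congr (by ext w; simp) fun _ _ => rfl
  · exact Finset.prod_congr (by ext w; simp) fun _ _ => rfl

lemma sepProb_nonneg {p : Param J D} (hp : p ∈ paramSpace J D) (z : Fin J) (S : Separation D) :
    0 ≤ sepProb p z S := by
  refine mul_nonneg (by positivity) (Finset.prod_nonneg fun w _ => ?_)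
  have := hp.1 z w
  split_ifs <;> linarith

lemma sepProb_le_one {p : Param J D} (hp : p ∈ paramSpace J D) (z : Fin J) (S : Separation D) :
    sepProb p z S ≤ 1 := by
  rw [← sum_sepProb p z]
  exact Finset.single_le_sum (fun S _ => sepProb_nonneg hp z S) (Finset.mem_univ S)

lemma sentenceLik_nonneg {p : Param J D} (hp : p ∈ paramSpace J D) (z : Fin J)
    (s : SentenceObs 𝓔) : 0 ≤ sentenceLik p z s :=
  mul_nonneg (Finset.sum_nonneg fun S _ => sepProb_nonneg hp z S)
    (Finset.prod_nonneg fun _ _ => mul_nonneg (hp.2.1 z).le (Real.exp_pos _).le)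

lemma lik_nonneg {p : Param J D} (hp : p ∈ paramSpace J D) (x : Obs 𝓔) : 0 ≤ lik p x :=
  mul_nonneg (div_nonneg (mul_nonneg (pow_nonneg hp.2.2.2.2.le _) (Real.exp_pos _).le)
    (by positivity)) (Finset.sum_nonneg fun z _ => mul_nonneg (hp.2.2.1 z).le
      (Finset.prod_nonneg fun _ _ => sentenceLik_nonneg hp z _))

end

/-! ### The likelihood is a density -/

lemma measurable_pi_fin_prod {α M : Type*} [MeasurableSpace α] [CommMonoid M] [MeasurableSpace M]
    [MeasurableMul₂ M] {n : ℕ} {f : α → M} (hf : Measurable f) :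
    Measurable fun x : Fin n → α => ∏ k, f (x k) :=
  Finset.measurable_fun_prod _ fun k _ => hf.comp (measurable_pi_apply k)

/-- The reference measure on sentences: counting measure for the events, Lebesgue measure on
`[0, ∞)` for the gap times. -/
def sentenceRef (𝓔 : Type*) : Measure (SentenceObs 𝓔) :=
  sigmaMeasure fun E => Measure.pi fun _ : Fin E.length => volume.restrict (Set.Ici (0 : ℝ))

/-- The reference measure on observations of one examinee. -/
def obsRef (𝓔 : Type*) : Measure (Obs 𝓔) :=
  sigmaMeasure fun K => Measure.pi fun _ : Fin K => sentenceRef 𝓔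

instance {𝓔 : Type*} [Finite 𝓔] : SigmaFinite (sentenceRef 𝓔) := by
  unfold sentenceRef; infer_instance

section

variable {𝓔 : Type*}

/-- The density of a sentence whose separation has weights `c` and whose gap times are independent
with density `g`. -/
def sepDensity (D : Finset (List 𝓔)) (c : Separation D → ℝ≥0∞) (g : ℝ → ℝ≥0∞)
    (s : SentenceObs 𝓔) : ℝ≥0∞ :=
  (∑ S ∈ separations D s.1, c S) * ∏ u, g (s.2 u)

lemma measurable_sepDensity (D : Finset (List 𝓔)) (c : Separation D → ℝ≥0∞) {g : ℝ → ℝ≥0∞}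
    (hg : Measurable g) : Measurable (sepDensity D c g) := by
  exact measurable_sigma_of fun E =>
    (measurable_pi_fin_prod hg).const_mul (∑ S ∈ separations D E, c S)

lemma sum_separation_eq_tsum (D : Finset (List 𝓔)) (c : Separation D → ℝ≥0∞)
    (a : List 𝓔 → ℝ≥0∞) :
    ∑ S : Separation D, c S * a S.sentence = ∑' E, (∑ S ∈ separations D E, c S) * a E := by
  classical
  have h : ∀ E, (∑ S ∈ separations D E, c S) * a E =
      ∑ S : Separation D, if E = S.sentence then c S * a S.sentence else 0 := by
    intro E
    rw [separations, Finset.sum_filter, Finset.sum_mul]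
    refine Finset.sum_congr rfl fun S _ => ?_
    by_cases hE : S.sentence = E
    · rw [if_pos hE, if_pos hE.symm, hE]
    · rw [if_neg hE, if_neg fun h => hE h.symm, zero_mul]
  simp_rw [h]
  rw [Summable.tsum_finsetSum fun _ _ => ENNReal.summable]
  exact Finset.sum_congr rfl fun S _ => (tsum_ite_eq S.sentence fun _ => c S * a S.sentence).symm

lemma sum_smul_map_eq_withDensity [Finite 𝓔] (D : Finset (List 𝓔)) (c : Separation D → ℝ≥0∞)
    {g : ℝ → ℝ≥0∞} (hg : Measurable g)
    [SigmaFinite ((volume.restrict (Set.Ici (0 : ℝ))).withDensity g)] :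
    ∑ S : Separation D, c S • Measure.map
      (fun t : Fin S.sentence.length → ℝ => (⟨S.sentence, t⟩ : SentenceObs 𝓔))
      (Measure.pi fun _ => (volume.restrict (Set.Ici (0 : ℝ))).withDensity g) =
      (sentenceRef 𝓔).withDensity (sepDensity D c g) := by
  rw [sentenceRef, sigmaMeasure_withDensity _ (measurable_sepDensity D c hg)]
  ext s hs
  rw [Measure.finsetSum_apply, sigmaMeasure_apply _ hs]
  set i : ∀ E : List 𝓔, (Fin E.length → ℝ) → SentenceObs 𝓔 := fun E t => ⟨E, t⟩ with hi
  have h1 : ∀ E : List 𝓔, ((Measure.pi fun _ : Fin E.length =>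
      volume.restrict (Set.Ici (0 : ℝ))).withDensity fun b => sepDensity D c g ⟨E, b⟩)
        (i E ⁻¹' s) = (∑ S ∈ separations D E, c S) *
      (Measure.pi fun _ : Fin E.length => (volume.restrict (Set.Ici (0 : ℝ))).withDensity g)
        (i E ⁻¹' s) := by
    intro E
    have hE : MeasurableSet (i E ⁻¹' s) := measurableSet_sigma.1 hs E
    rw [pi_withDensity_fin _ _ _ hg, withDensity_apply _ hE, withDensity_apply _ hE,
      ← lintegral_const_mul _ (measurable_pi_fin_prod hg)]
    rfl
  rw [tsum_congr h1, ← sum_separation_eq_tsum D c fun E => (Measure.pi fun _ : Fin E.length =>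
      (volume.restrict (Set.Ici (0 : ℝ))).withDensity g) (i E ⁻¹' s)]
  refine Finset.sum_congr rfl fun S _ => ?_
  rw [Measure.smul_apply, smul_eq_mul]
  congr 1
  exact Measure.map_apply (measurable_sigmaMk S.sentence) hs

lemma expMeasure_eq_withDensity (r : ℝ) :
    expMeasure r = (volume.restrict (Set.Ici (0 : ℝ))).withDensity
      fun t => ENNReal.ofReal (r * Real.exp (-(r * t))) := by
  rw [← withDensity_indicator measurableSet_Ici]
  change volume.withDensity (exponentialPDF r) = _
  congr 1
  ext t
  rw [exponentialPDF_eq]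
  by_cases ht : 0 ≤ t
  · rw [if_pos ht, Set.indicator_of_mem (Set.mem_Ici.2 ht)]
  · rw [if_neg ht, Set.indicator_of_notMem (by simpa using ht), ENNReal.ofReal_zero]

variable {J : ℕ} {D : Finset (List 𝓔)} {p : Param J D}

lemma ofReal_sentenceLik (hp : p ∈ paramSpace J D) (z : Fin J) (s : SentenceObs 𝓔) :
    ENNReal.ofReal (sentenceLik p z s) =
      sepDensity D (fun S => ENNReal.ofReal (sepProb p z S))
        (fun t => ENNReal.ofReal (p.lam z * Real.exp (-(p.lam z * t)))) s := by
  rw [sentenceLik, sepDensity,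
    ENNReal.ofReal_mul (Finset.sum_nonneg fun S _ => sepProb_nonneg hp z S),
    ENNReal.ofReal_sum_of_nonneg fun S _ => sepProb_nonneg hp z S,
    ENNReal.ofReal_prod_of_nonneg fun _ _ => mul_nonneg (hp.2.1 z).le (Real.exp_pos _).le]

lemma measurable_ofReal_sentenceLik (hp : p ∈ paramSpace J D) (z : Fin J) :
    Measurable fun s => ENNReal.ofReal (sentenceLik p z s) := by
  simp_rw [ofReal_sentenceLik hp]
  exact measurable_sepDensity _ _ (by fun_prop)

lemma sentenceLaw_eq_withDensity [Finite 𝓔] (hp : p ∈ paramSpace J D) (z : Fin J) :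
    sentenceLaw p z =
      (sentenceRef 𝓔).withDensity fun s => ENNReal.ofReal (sentenceLik p z s) := by
  simp_rw [ofReal_sentenceLik hp]
  rw [sentenceLaw, expMeasure_eq_withDensity,
    sum_smul_map_eq_withDensity D (fun S => ENNReal.ofReal (sepProb p z S)) (by fun_prop)]

lemma isProbabilityMeasure_sentenceLaw (hp : p ∈ paramSpace J D) (z : Fin J) :
    IsProbabilityMeasure (sentenceLaw p z) := by
  have := isProbabilityMeasure_expMeasure (hp.2.1 z)
  constructor
  have h : ∀ S : Separation D, Measure.map
      (fun t : Fin S.sentence.length → ℝ => (⟨S.sentence, t⟩ : SentenceObs 𝓔))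
      (Measure.pi fun _ => expMeasure (p.lam z)) Set.univ = 1 := by
    intro S
    have := Measure.isProbabilityMeasure_map (μ := Measure.pi fun _ : Fin S.sentence.length =>
      expMeasure (p.lam z)) (measurable_sigmaMk (β := fun E : List 𝓔 => Fin E.length → ℝ)
        S.sentence).aemeasurable
    exact measure_univ
  rw [sentenceLaw, Measure.finsetSum_apply]
  simp_rw [Measure.smul_apply, h, smul_eq_mul, mul_one]
  rw [← ENNReal.ofReal_sum_of_nonneg fun S _ => sepProb_nonneg hp z S, sum_sepProb,
    ENNReal.ofReal_one]

lemma ofReal_lik (hp : p ∈ paramSpace J D) (x : Obs 𝓔) :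
    ENNReal.ofReal (lik p x) =
      ENNReal.ofReal (p.kappa ^ x.1 * Real.exp (-p.kappa) / (x.1.factorial : ℝ)) *
        ∑ z, ENNReal.ofReal (p.prob z) * ∏ k, ENNReal.ofReal (sentenceLik p z (x.2 k)) := by
  have h0 : ∀ z, 0 ≤ ∏ k, sentenceLik p z (x.2 k) := fun z =>
    Finset.prod_nonneg fun _ _ => sentenceLik_nonneg hp z _
  rw [lik, ENNReal.ofReal_mul (div_nonneg (mul_nonneg (pow_nonneg hp.2.2.2.2.le _)
    (Real.exp_pos _).le) (by positivity)),
    ENNReal.ofReal_sum_of_nonneg fun z _ => mul_nonneg (hp.2.2.1 z).le (h0 z)]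
  congr 1
  refine Finset.sum_congr rfl fun z _ => ?_
  rw [ENNReal.ofReal_mul (hp.2.2.1 z).le,
    ENNReal.ofReal_prod_of_nonneg fun _ _ => sentenceLik_nonneg hp z _]

lemma measurable_lik (p : Param J D) : Measurable (lik p) := by
  have h : ∀ z, Measurable (sentenceLik p z) := by
    intro z
    have hg : Measurable fun t => p.lam z * Real.exp (-(p.lam z * t)) := by fun_prop
    exact measurable_sigma_of fun E =>
      (measurable_pi_fin_prod hg).const_mul (∑ S ∈ separations D E, sepProb p z S)
  exact measurable_sigma_of fun K => (Finset.measurable_fun_sum _ fun z _ =>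
    (measurable_pi_fin_prod (h z)).const_mul (p.prob z)).const_mul
      (p.kappa ^ K * Real.exp (-p.kappa) / (K.factorial : ℝ))

lemma law_eq_sigmaMeasure (p : Param J D) :
    law p = sigmaMeasure fun K =>
      ENNReal.ofReal (p.kappa ^ K * Real.exp (-p.kappa) / (K.factorial : ℝ)) •
        ∑ z : Fin J, ENNReal.ofReal (p.prob z) •
          Measure.pi fun _ : Fin K => sentenceLaw p z := by
  rw [law, sigmaMeasure]
  congr 1
  ext1 K
  rw [Measure.map_smul]

lemma law_eq_withDensity [Finite 𝓔] (hp : p ∈ paramSpace J D) :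
    law p = (obsRef 𝓔).withDensity fun x => ENNReal.ofReal (lik p x) := by
  rw [law_eq_sigmaMeasure, obsRef,
    sigmaMeasure_withDensity _ (measurable_lik p).ennreal_ofReal]
  congr 1
  ext1 K
  have hm : ∀ z, Measurable fun s => ENNReal.ofReal (sentenceLik p z s) :=
    measurable_ofReal_sentenceLik hp
  have hmz : ∀ z, Measurable fun x : Fin K → SentenceObs 𝓔 =>
      ENNReal.ofReal (p.prob z) * ∏ k, ENNReal.ofReal (sentenceLik p z (x k)) :=
    fun z => (measurable_pi_fin_prod (hm z)).const_mul _
  ext s hs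
  simp_rw [ofReal_lik hp]
  rw [withDensity_apply _ hs, lintegral_const_mul _ (Finset.measurable_fun_sum _ fun z _ => hmz z),
    lintegral_finsetSum _ fun z _ => hmz z, Measure.smul_apply, smul_eq_mul,
    Measure.finsetSum_apply]
  congr 1
  refine Finset.sum_congr rfl fun z _ => ?_
  have : SigmaFinite ((sentenceRef 𝓔).withDensity fun s => ENNReal.ofReal (sentenceLik p z s)) := by
    have := isProbabilityMeasure_sentenceLaw hp z
    rw [← sentenceLaw_eq_withDensity hp]; infer_instance
  rw [lintegral_const_mul _ (measurable_pi_fin_prod (hm z)), Measure.smul_apply, smul_eq_mul,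
    sentenceLaw_eq_withDensity hp, pi_withDensity_fin _ _ _ (hm z), withDensity_apply _ hs]

lemma law_rectangle (hp : p ∈ paramSpace J D) {K : ℕ} {B : Fin K → Set (SentenceObs 𝓔)}
    (hB : ∀ k, MeasurableSet (B k)) :
    law p (Sigma.mk K '' Set.univ.pi B) =
      ENNReal.ofReal (p.kappa ^ K * Real.exp (-p.kappa) / (K.factorial : ℝ)) *
        ∑ z, ENNReal.ofReal (p.prob z) * ∏ k, sentenceLaw p z (B k) := by
  have : ∀ z, IsProbabilityMeasure (sentenceLaw p z) := isProbabilityMeasure_sentenceLaw hp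
  rw [law_eq_sigmaMeasure]
  refine (sigmaMeasure_image (β := fun K => Fin K → SentenceObs 𝓔) _ K
    (MeasurableSet.univ_pi hB)).trans ?_
  rw [Measure.smul_apply,
    smul_eq_mul, Measure.finsetSum_apply]
  simp_rw [Measure.smul_apply, smul_eq_mul, Measure.pi_pi]

lemma isProbabilityMeasure_law (hp : p ∈ paramSpace J D) : IsProbabilityMeasure (law p) := by
  have : ∀ z, IsProbabilityMeasure (sentenceLaw p z) := isProbabilityMeasure_sentenceLaw hp
  constructor
  rw [law_eq_sigmaMeasure, sigmaMeasure_apply _ MeasurableSet.univ]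
  have h : ∀ K : ℕ, (ENNReal.ofReal (p.kappa ^ K * Real.exp (-p.kappa) / (K.factorial : ℝ)) •
        ∑ z : Fin J, ENNReal.ofReal (p.prob z) •
          Measure.pi fun _ : Fin K => sentenceLaw p z) 
          ((fun s => (⟨K, s⟩ : Obs 𝓔)) ⁻¹' Set.univ) =
      ENNReal.ofReal (p.kappa ^ K * Real.exp (-p.kappa) / (K.factorial : ℝ)) := by
    intro K
    rw [Set.preimage_univ, Measure.smul_apply, Measure.finsetSum_apply]
    simp_rw [Measure.smul_apply, measure_univ, smul_eq_mul, mul_one]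
    rw [← ENNReal.ofReal_sum_of_nonneg fun z _ => (hp.2.2.1 z).le, hp.2.2.2.1, ENNReal.ofReal_one,
      mul_one]
  rw [tsum_congr h]
  have hs : HasSum (fun K : ℕ => p.kappa ^ K * Real.exp (-p.kappa) / (K.factorial : ℝ)) 1 := by
    have := (NormedSpace.expSeries_div_hasSum_exp (𝔸 := ℝ) p.kappa).mul_right (Real.exp (-p.kappa))
    rw [← Real.exp_eq_exp_ℝ, ← Real.exp_add, add_neg_cancel, Real.exp_zero] at this
    refine this.congr_fun ?_
    intro K
    ring
  rw [← ENNReal.ofReal_tsum_of_nonneg (fun K => div_nonneg (mul_nonneg (pow_nonneg hp.2.2.2.2.le _)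
    (Real.exp_pos _).le) (by positivity)) hs.summable, hs.tsum_eq, ENNReal.ofReal_one]

/-! ### Domination on compact sets of parameters -/

lemma exists_dominating [Finite 𝓔] {C : Set (Param J D)} (hC : IsCompact C)
    (hCsub : C ⊆ paramSpace J D) :
    ∃ G : Obs 𝓔 → ℝ≥0∞, ∫⁻ x, G x ∂(obsRef 𝓔) ≠ ∞ ∧
      ∀ q ∈ C, ∀ x, ENNReal.ofReal (lik q x) ≤ G x := by
  have hlamc : ∀ j, Continuous fun q : Param J D => q.lam j := fun j => by
    unfold Param.lam; fun_prop
  have hlo : ∀ j, ∃ a, 0 < a ∧ ∀ q ∈ C, a ≤ q.lam j := fun j =>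
    hC.exists_forall_le' (hlamc j).continuousOn fun q hq => (hCsub hq).2.1 j
  have hhi : ∀ j, ∃ b, 0 < b ∧ ∀ q ∈ C, q.lam j ≤ b := fun j => by
    obtain ⟨b, hb⟩ := hC.bddAbove_image (hlamc j).continuousOn
    exact ⟨max b 1, by positivity, fun q hq => le_max_of_le_left (hb ⟨q, hq, rfl⟩)⟩
  choose a ha0 ha using hlo
  choose b hb0 hb using hhi
  obtain ⟨M, hM0, hM⟩ : ∃ M, 0 < M ∧ ∀ q ∈ C, q.kappa ≤ M := by
    obtain ⟨b, hb⟩ := hC.bddAbove_image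
      (show ContinuousOn (fun q : Param J D => q.kappa) C by unfold Param.kappa; fun_prop)
    exact ⟨max b 1, by positivity, fun q hq => le_max_of_le_left (hb ⟨q, hq, rfl⟩)⟩
  set g : ℝ → ℝ≥0∞ := fun t => ∑ j, ENNReal.ofReal
    (b j * (Real.exp (-(a j * t)) + Real.exp (-(b j * t)))) with hg
  have hgm : Measurable g := by fun_prop
  have hexp : ∀ (r : ℝ), 0 < r → ∫⁻ t in Set.Ici (0 : ℝ), ENNReal.ofReal (Real.exp (-(r * t))) ≠ ∞ := by
    intro r hr
    have h : IntegrableOn (fun t : ℝ => Real.exp (-(r * t))) (Set.Ici 0) := by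
      rw [integrableOn_Ici_iff_integrableOn_Ioi]
      simpa using exp_neg_integrableOn_Ioi 0 hr
    exact h.lintegral_lt_top.ne
  have hgfin : ∫⁻ t, g t ∂(volume.restrict (Set.Ici (0 : ℝ))) ≠ ∞ := by
    simp only [hg]
    rw [lintegral_finsetSum _ fun j _ => by fun_prop]
    refine ENNReal.sum_ne_top.2 fun j _ => ?_
    simp_rw [ENNReal.ofReal_mul (hb0 j).le,
      ENNReal.ofReal_add (Real.exp_pos _).le (Real.exp_pos _).le]
    rw [lintegral_const_mul _ (by fun_prop), lintegral_add_left (by fun_prop)]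
    exact ENNReal.mul_ne_top ENNReal.ofReal_ne_top
      (ENNReal.add_ne_top.2 ⟨hexp _ (ha0 j), hexp _ (hb0 j)⟩)
  have : IsFiniteMeasure ((volume.restrict (Set.Ici (0 : ℝ))).withDensity g) :=
    isFiniteMeasure_withDensity hgfin
  set h : SentenceObs 𝓔 → ℝ≥0∞ := sepDensity D (fun _ => 1) g with hh
  have hhm : Measurable h := measurable_sepDensity D _ hgm
  have hhfin : ∫⁻ s, h s ∂(sentenceRef 𝓔) ≠ ∞ := by
    rw [← setLIntegral_univ, ← withDensity_apply _ MeasurableSet.univ,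
      ← sum_smul_map_eq_withDensity D _ hgm, Measure.finsetSum_apply]
    refine ENNReal.sum_ne_top.2 fun S _ => ?_
    rw [one_smul]
    exact measure_ne_top _ _
  refine ⟨fun x => ENNReal.ofReal (M ^ x.1 / (x.1.factorial : ℝ)) * ∏ k, h (x.2 k), ?_, ?_⟩
  · rw [obsRef, lintegral_sigmaMeasure _ (measurable_sigma_of fun K =>
      (measurable_pi_fin_prod hhm).const_mul (ENNReal.ofReal (M ^ K / (K.factorial : ℝ))))]
    have e : ∀ K : ℕ, ∫⁻ y : Fin K → SentenceObs 𝓔, ENNReal.ofReal (M ^ K / (K.factorial : ℝ)) *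
        ∏ k, h (y k) ∂(Measure.pi fun _ => sentenceRef 𝓔) =
        ENNReal.ofReal ((M * (∫⁻ s, h s ∂(sentenceRef 𝓔)).toReal) ^ K / (K.factorial : ℝ)) := by
      intro K
      rw [lintegral_const_mul _ (measurable_pi_fin_prod hhm), lintegral_pi_fin_prod _ K (fun _ => h) fun _ => hhm,
        Finset.prod_const, Finset.card_univ, Fintype.card_fin, mul_pow, mul_div_right_comm,
        ENNReal.ofReal_mul (by positivity), ENNReal.ofReal_pow ENNReal.toReal_nonneg,
        ENNReal.ofReal_toReal hhfin]
    rw [tsum_congr e, ← ENNReal.ofReal_tsum_of_nonneg (fun K => by positivity)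
      (Real.summable_pow_div_factorial _)]
    exact ENNReal.ofReal_ne_top
  · intro q hq x
    have hqp := hCsub hq
    have hbound : ∀ z s, ENNReal.ofReal (sentenceLik q z s) ≤ h s := by
      intro z s
      rw [ofReal_sentenceLik hqp]
      refine mul_le_mul' (Finset.sum_le_sum fun S _ => ?_) (Finset.prod_le_prod' fun u _ => ?_)
      · exact ENNReal.ofReal_le_one.2 (sepProb_le_one hqp z S)
      · refine le_trans ?_ (Finset.single_le_sum (f := fun j => ENNReal.ofReal
          (b j * (Real.exp (-(a j * s.2 u)) + Real.exp (-(b j * s.2 u))))) (fun _ _ => zero_le)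
            (Finset.mem_univ z))
        refine ENNReal.ofReal_le_ofReal (mul_le_mul (hb z q hq) ?_ (Real.exp_pos _).le (hb0 z).le)
        rcases le_total 0 (s.2 u) with h0 | h0
        · refine le_add_of_le_of_nonneg (Real.exp_le_exp.2 ?_) (Real.exp_pos _).le
          nlinarith [ha z q hq]
        · refine le_add_of_nonneg_of_le (Real.exp_pos _).le (Real.exp_le_exp.2 ?_)
          nlinarith [hb z q hq]
    rw [ofReal_lik hqp]
    refine mul_le_mul' (ENNReal.ofReal_le_ofReal ?_) ?_
    · have hk0 := hqp.2.2.2.2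
      refine div_le_div_of_nonneg_right ?_ (by positivity)
      calc q.kappa ^ x.1 * Real.exp (-q.kappa) ≤ q.kappa ^ x.1 * 1 :=
            mul_le_mul_of_nonneg_left (Real.exp_le_one_iff.2 (by linarith)) (by positivity)
        _ ≤ M ^ x.1 := by
            rw [mul_one]
            exact pow_le_pow_left₀ hk0.le (hM q hq) _
    · calc _ ≤ ∑ z, ENNReal.ofReal (q.prob z) * ∏ k, h (x.2 k) :=
            Finset.sum_le_sum fun z _ => mul_le_mul_right (Finset.prod_le_prod' fun k _ => hbound z _) _
        _ = _ := by
            rw [← Finset.sum_mul, ← ENNReal.ofReal_sum_of_nonneg fun z _ => (hqp.2.2.1 z).le,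
              hqp.2.2.2.1, ENNReal.ofReal_one, one_mul]

end

/-! ### A single class is determined by its sentence probabilities -/

section

variable {𝓔 : Type*} {J : ℕ} {D : Finset (List 𝓔)}

/-- The probability that a sentence of class `z` consists of the events `E`. -/
def sentenceProb (p : Param J D) (z : Fin J) (E : List 𝓔) : ℝ :=
  ∑ S ∈ separations D E, sepProb p z S

/-- The odds `θ / (1 - θ)` of a pattern. -/
def odds (p : Param J D) (z : Fin J) (w : List 𝓔) : ℝ :=
  p.thetaExt z w / (1 - p.thetaExt z w)

lemma thetaExt_coe (p : Param J D) (z : Fin J) (w : {w // w ∈ D}) :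
    p.thetaExt z w = p.theta z w := by
  simp [Param.thetaExt]

lemma thetaExt_of_notMem (p : Param J D) (z : Fin J) {w : List 𝓔} (hw : w ∉ D) :
    p.thetaExt z w = 0 := by
  simp [Param.thetaExt, hw]

lemma odds_of_notMem (p : Param J D) (z : Fin J) {w : List 𝓔} (hw : w ∉ D) :
    odds p z w = 0 := by
  simp [odds, thetaExt_of_notMem p z hw]

lemma mem_separations {E : List 𝓔} {S : Separation D} :
    S ∈ separations D E ↔ S.sentence = E := by
  simp [separations]

lemma sepProb_eq_odds {p : Param J D} {z : Fin J} (h : ∀ w, p.theta z w < 1)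
    (S : Separation D) :
    sepProb p z S = (∏ w, (1 - p.theta z w)) *
      (1 / (S.1.length.factorial : ℝ) * ((S.1.map Subtype.val).map (odds p z)).prod) := by
  classical
  have e : ∀ w : {w // w ∈ D}, (if w ∈ S.1 then p.theta z w else 1 - p.theta z w) =
      (1 - p.theta z w) * if w ∈ S.1.toFinset then odds p z w else 1 := by
    intro w
    have hw : 1 - p.theta z w ≠ 0 := (sub_pos.2 (h w)).ne'
    simp only [List.mem_toFinset]
    split_ifs
    · rw [odds, thetaExt_coe, mul_div_cancel₀ _ hw]
    · rw [mul_one]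
  have e2 : (∏ w : {w // w ∈ D}, if w ∈ S.1.toFinset then odds p z w else 1) =
      ((S.1.map Subtype.val).map (odds p z)).prod := by
    rw [Finset.prod_ite_mem, Finset.univ_inter, List.map_map]
    exact List.prod_toFinset _ S.2
  rw [sepProb, Finset.prod_congr rfl fun w _ => e w, Finset.prod_mul_distrib, e2]
  ring

open Classical in
/-- The contribution of a sequence of patterns to the probability of the sentence `E`, relative to
the probability of the empty sentence, when the odds of the patterns are `o`. -/
def splitWeight (o : List 𝓔 → ℝ) (E : List 𝓔) (L : List (List 𝓔)) : ℝ :=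
  if L.flatten = E ∧ [] ∉ L ∧ L.Nodup then
    1 / (L.length.factorial : ℝ) * (L.map o).prod else 0

open Classical in
/-- All sequences of distinct patterns of a dictionary. -/
def patternSequences (D : Finset (List 𝓔)) : Finset (List (List 𝓔)) :=
  Finset.univ.image fun S : Separation D => S.1.map Subtype.val

lemma map_val_injective : Function.Injective fun S : Separation D => S.1.map Subtype.val :=
  fun _ _ h => Subtype.ext (List.map_injective_iff.2 Subtype.val_injective h)

lemma mem_patternSequences {L : List (List 𝓔)} (hL : L.Nodup) (h : ∀ w ∈ L, w ∈ D) :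
    L ∈ patternSequences D := by
  classical
  refine Finset.mem_image.2 ⟨⟨L.attach.map fun w => ⟨w.1, h w.1 w.2⟩, ?_⟩, Finset.mem_univ _, ?_⟩
  · refine (List.nodup_attach.2 hL).map fun a b hab => ?_
    exact Subtype.ext (congrArg (fun w : {w // w ∈ D} => w.1) hab)
  · simp [List.map_map, Function.comp_def]

lemma splitWeight_eq_zero (p : Param J D) (z : Fin J) (E : List 𝓔) {L : List (List 𝓔)}
    (hL : L ∉ patternSequences D) : splitWeight (odds p z) E L = 0 := by
  rw [splitWeight]
  split_ifs with h
  · have : ∃ w ∈ L, w ∉ D := by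
      by_contra! hw
      exact hL (mem_patternSequences h.2.2 hw)
    obtain ⟨w, hwL, hwD⟩ := this
    rw [List.prod_eq_zero (List.mem_map.2 ⟨w, hwL, odds_of_notMem p z hwD⟩), mul_zero]
  · rfl

lemma sentenceProb_eq (hD : IsDictionary D) {p : Param J D} {z : Fin J}
    (h : ∀ w, p.theta z w < 1) (E : List 𝓔) {A : Finset (List (List 𝓔))}
    (hA : patternSequences D ⊆ A) :
    sentenceProb p z E = (∏ w, (1 - p.theta z w)) * ∑ L ∈ A, splitWeight (odds p z) E L := by
  classical
  rw [← Finset.sum_subset hA fun L _ hL => splitWeight_eq_zero p z E hL, patternSequences,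
    Finset.sum_image fun S _ S' _ h => map_val_injective h, Finset.mul_sum, sentenceProb,
    separations, Finset.sum_filter]
  refine Finset.sum_congr rfl fun S _ => ?_
  have hn : [] ∉ S.1.map Subtype.val := by
    intro hmem
    obtain ⟨w, _, hw⟩ := List.mem_map.1 hmem
    exact (hD w.1 w.2).1 hw
  have hnd : (S.1.map Subtype.val).Nodup := S.2.map Subtype.val_injective
  rw [splitWeight, sepProb_eq_odds h]
  by_cases hE : S.sentence = E
  · rw [if_pos hE, if_pos ⟨hE, hn, hnd⟩, List.length_map]
  · rw [if_neg hE, if_neg fun h' => hE h'.1, mul_zero]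

lemma sentenceProb_nil (hD : IsDictionary D) (p : Param J D) (z : Fin J) :
    sentenceProb p z [] = ∏ w, (1 - p.theta z w) := by
  have h : separations D [] = {⟨[], List.nodup_nil⟩} := by
    ext S
    rw [mem_separations, Finset.mem_singleton]
    constructor
    · intro hS
      refine Subtype.ext (List.eq_nil_iff_forall_not_mem.2 fun w hw => (hD w.1 w.2).1 ?_)
      exact List.flatten_eq_nil_iff.1 hS _ (List.mem_map_of_mem hw)
    · rintro rfl
      rfl
  rw [sentenceProb, h, Finset.sum_singleton, sepProb]
  simp

lemma length_lt_of_mem_of_flatten_eq {L : List (List 𝓔)} {E w : List 𝓔} (hL : L.flatten = E)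
    (hn : [] ∉ L) (hne : L ≠ [E]) (hw : w ∈ L) : w.length < E.length := by
  obtain ⟨a, b, rfl⟩ := List.append_of_mem hw
  subst hL
  have ha : a ≠ [] → 0 < a.flatten.length := by
    intro h
    obtain ⟨v, hv⟩ := List.exists_mem_of_ne_nil a h
    refine List.length_pos_iff.2 fun h0 => hn ?_
    rw [← List.flatten_eq_nil_iff.1 h0 v hv]
    simp [hv]
  have hb : b ≠ [] → 0 < b.flatten.length := by
    intro h
    obtain ⟨v, hv⟩ := List.exists_mem_of_ne_nil b h
    refine List.length_pos_iff.2 fun h0 => hn ?_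
    rw [← List.flatten_eq_nil_iff.1 h0 v hv]
    simp [hv]
  rw [List.flatten_append, List.flatten_cons, List.length_append, List.length_append]
  by_cases h1 : a = []
  · by_cases h2 : b = []
    · subst h1 h2
      simp at hne
    · have := hb h2
      omega
  · have := ha h1
    omega

variable {J' : ℕ} {D' : Finset (List 𝓔)}

lemma thetaExt_eq_of_sentenceProb_eq (hD : IsDictionary D) (hD' : IsDictionary D')
    {p : Param J D} {p' : Param J' D'} (hp' : p' ∈ paramSpace J' D') {z : Fin J} {z' : Fin J'}
    (hlt : ∀ w, p.theta z w < 1) (h : ∀ E, sentenceProb p z E = sentenceProb p' z' E) (w : List 𝓔) :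
    p.thetaExt z w = p'.thetaExt z' w := by
  classical
  have h0 : ∏ w, (1 - p.theta z w) = ∏ w, (1 - p'.theta z' w) := by
    rw [← sentenceProb_nil hD, ← sentenceProb_nil hD', h]
  have hpos : 0 < ∏ w, (1 - p.theta z w) := Finset.prod_pos fun w _ => by linarith [hlt w]
  have hlt' : ∀ w, p'.theta z' w < 1 := by
    intro w
    have hne := Finset.prod_ne_zero_iff.1 (h0 ▸ hpos.ne') w (Finset.mem_univ w)
    exact lt_of_le_of_ne (hp'.1 z' w).2 fun h1 => hne (by rw [h1, sub_self])
  have hodds : ∀ n, ∀ w : List 𝓔, w.length = n → odds p z w = odds p' z' w := by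
    intro n
    induction n using Nat.strong_induction_on with
    | _ n ih =>
      intro E hE
      by_cases hE0 : E = []
      · subst hE0
        rw [odds_of_notMem p z fun h => (hD _ h).1 rfl, odds_of_notMem p' z' fun h => (hD' _ h).1 rfl]
      set A := insert [E] (patternSequences D ∪ patternSequences D') with hA
      have h1 := sentenceProb_eq hD hlt E (A := A)
        (Finset.subset_union_left.trans (Finset.subset_insert _ _))
      have h2 := sentenceProb_eq hD' hlt' E (A := A)
        (Finset.subset_union_right.trans (Finset.subset_insert _ _))
      rw [← h E, h1, ← h0] at h2
      have h3 := mul_left_cancel₀ hpos.ne' h2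
      have hmem : [E] ∈ A := Finset.mem_insert_self _ _
      rw [← Finset.add_sum_erase _ _ hmem, ← Finset.add_sum_erase _ _ hmem] at h3
      have h4 : ∑ L ∈ A.erase [E], splitWeight (odds p z) E L =
          ∑ L ∈ A.erase [E], splitWeight (odds p' z') E L := by
        refine Finset.sum_congr rfl fun L hL => ?_
        rw [splitWeight, splitWeight]
        split_ifs with hc
        · congr 2
          refine List.map_congr_left fun v hv => ?_
          have hv' := length_lt_of_mem_of_flatten_eq hc.1 hc.2.1 (Finset.ne_of_mem_erase hL) hv
          exact ih v.length (hE ▸ hv') v rfl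
        · rfl
      rw [h4] at h3
      have h5 := add_right_cancel h3
      have hsingle : ∀ o : List 𝓔 → ℝ, splitWeight o E [E] = o E := by
        intro o
        rw [splitWeight, if_pos ⟨by simp, by simpa using fun h : [] = E => hE0 h.symm, by simp⟩]
        simp
      rwa [hsingle, hsingle] at h5
  have hext : ∀ {J : ℕ} {D : Finset (List 𝓔)} {p : Param J D} {z : Fin J},
      (∀ w, p.theta z w < 1) → p.thetaExt z w < 1 := by
    intro J D p z hlt
    by_cases hw : w ∈ D
    · exact (thetaExt_coe p z ⟨w, hw⟩).trans_lt (hlt _)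
    · rw [thetaExt_of_notMem p z hw]; exact one_pos
  have ho := hodds _ w rfl
  have ha := hext hlt
  have hb := hext hlt'
  rw [odds, odds, div_eq_div_iff (by linarith) (by linarith)] at ho
  linarith

/-! ### A single class is determined by its law -/

lemma sentenceLaw_image_pi {p : Param J D} (hp : p ∈ paramSpace J D) (z : Fin J) (E : List 𝓔)
    {A : Set ℝ} (hA : MeasurableSet A) :
    sentenceLaw p z ((fun t : Fin E.length → ℝ => (⟨E, t⟩ : SentenceObs 𝓔)) ''
      Set.univ.pi fun _ => A) =
      ENNReal.ofReal (sentenceProb p z E) * expMeasure (p.lam z) A ^ E.length := by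
  classical
  have := isProbabilityMeasure_expMeasure (hp.2.1 z)
  have hm : MeasurableSet ((fun t : Fin E.length → ℝ => (⟨E, t⟩ : SentenceObs 𝓔)) ''
      Set.univ.pi fun _ => A) :=
    measurableSet_sigma_image (β := fun E : List 𝓔 => Fin E.length → ℝ) E
      (MeasurableSet.univ_pi fun _ => hA)
  rw [sentenceLaw, Measure.finsetSum_apply, sentenceProb,
    ENNReal.ofReal_sum_of_nonneg fun S _ => sepProb_nonneg hp z S, Finset.sum_mul, separations,
    Finset.sum_filter]
  refine Finset.sum_congr rfl fun S _ => ?_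
  rw [Measure.smul_apply, smul_eq_mul,
    Measure.map_apply (measurable_sigmaMk (β := fun E : List 𝓔 => Fin E.length → ℝ) _) hm]
  by_cases h : S.sentence = E
  · subst h
    rw [if_pos rfl, Set.preimage_image_eq _
      (sigma_mk_injective (β := fun E : List 𝓔 => Fin E.length → ℝ)), Measure.pi_pi]
    simp
  · rw [if_neg h]
    have : (fun t : Fin S.sentence.length → ℝ => (⟨S.sentence, t⟩ : SentenceObs 𝓔)) ⁻¹'
        ((fun t : Fin E.length → ℝ => (⟨E, t⟩ : SentenceObs 𝓔)) '' Set.univ.pi fun _ => A) = ∅ :=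
      Set.preimage_image_sigmaMk_of_ne (α := fun E : List 𝓔 => Fin E.length → ℝ) h _
    rw [this, measure_empty, mul_zero]

lemma sentenceProb_nonneg {p : Param J D} (hp : p ∈ paramSpace J D) (z : Fin J) (E : List 𝓔) :
    0 ≤ sentenceProb p z E :=
  Finset.sum_nonneg fun S _ => sepProb_nonneg hp z S

lemma sentenceProb_pos {p : Param J D} (hp : p ∈ paramSpace J D) {z : Fin J}
    (hlt : ∀ w, p.theta z w < 1) {w : {w // w ∈ D}} (hw : p.theta z w ≠ 0) :
    0 < sentenceProb p z w.1 := by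
  set S : Separation D := ⟨[w], List.nodup_singleton w⟩ with hS
  have hmem : S ∈ separations D w.1 := mem_separations.2 (by simp [hS, Separation.sentence])
  refine lt_of_lt_of_le ?_ (Finset.single_le_sum (fun S _ => sepProb_nonneg hp z S) hmem)
  refine mul_pos (by positivity) (Finset.prod_pos fun v _ => ?_)
  split_ifs with hv
  · rw [List.mem_singleton.1 hv]
    exact lt_of_le_of_ne (hp.1 z w).1 hw.symm
  · linarith [hlt v]

lemma expMeasure_Iic_one {r : ℝ} (hr : 0 < r) :
    (expMeasure r).real (Set.Iic 1) = 1 - Real.exp (-r) := by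
  have := isProbabilityMeasure_expMeasure hr
  rw [← cdf_eq_real, cdf_expMeasure_eq hr, if_pos zero_le_one, mul_one]

lemma class_eq_of_sentenceLaw_eq (hD : IsDictionary D) (hD' : IsDictionary D')
    {p : Param J D} {p' : Param J' D'} (hp : p ∈ paramSpace J D) (hp' : p' ∈ paramSpace J' D')
    {z : Fin J} {z' : Fin J'} (hlt : ∀ w, p.theta z w < 1) (hclass : ∃ w, p.theta z w ≠ 0)
    (h : sentenceLaw p z = sentenceLaw p' z') :
    p.lam z = p'.lam z' ∧ ∀ w, p.thetaExt z w = p'.thetaExt z' w := by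
  have e1 := isProbabilityMeasure_expMeasure (hp.2.1 z)
  have e2 := isProbabilityMeasure_expMeasure (hp'.2.1 z')
  have hq : ∀ E, sentenceProb p z E = sentenceProb p' z' E := by
    intro E
    have h1 := sentenceLaw_image_pi hp z E MeasurableSet.univ
    rw [h, sentenceLaw_image_pi hp' z' E MeasurableSet.univ, measure_univ, measure_univ, one_pow,
      mul_one, mul_one,
      ENNReal.ofReal_eq_ofReal_iff (sentenceProb_nonneg hp' z' E) (sentenceProb_nonneg hp z E)] at h1
    exact h1.symm
  refine ⟨?_, thetaExt_eq_of_sentenceProb_eq hD hD' hp' hlt hq⟩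
  obtain ⟨w, hw⟩ := hclass
  have h1 := sentenceLaw_image_pi hp z w.1 (measurableSet_Iic (a := (1 : ℝ)))
  have hpos := sentenceProb_pos hp hlt hw
  rw [h, sentenceLaw_image_pi hp' z' w.1 measurableSet_Iic, ← hq,
    ENNReal.mul_right_inj (ENNReal.ofReal_pos.2 hpos).ne' ENNReal.ofReal_ne_top] at h1
  have h2 := congrArg ENNReal.toReal h1
  rw [ENNReal.toReal_pow, ENNReal.toReal_pow] at h2
  have hlen : w.1.length ≠ 0 := fun h0 => (hD w.1 w.2).1 (List.length_eq_zero_iff.1 h0)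
  have h3 := (pow_left_inj₀ ENNReal.toReal_nonneg ENNReal.toReal_nonneg hlen).1 h2
  have h4 : 1 - Real.exp (-p'.lam z') = 1 - Real.exp (-p.lam z) := by
    rw [← expMeasure_Iic_one (hp.2.1 z), ← expMeasure_Iic_one (hp'.2.1 z')]
    exact h3
  have h5 : Real.exp (-p'.lam z') = Real.exp (-p.lam z) := by linarith
  have := Real.exp_injective h5
  linarith

end

/-! ### The mixture is determined by the law -/

lemma exists_perm_of_sum_monoidHom_eq {M ι : Type*} [Monoid M] [Fintype ι] {χ χ' : ι → M →* ℝ}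
    {a a' : ι → ℝ} (hχ : Function.Injective χ) (ha : ∀ i, a i ≠ 0)
    (h : ∀ m, ∑ i, a i * χ i m = ∑ i, a' i * χ' i m) :
    ∃ ρ : Equiv.Perm ι, ∀ i, χ' (ρ i) = χ i ∧ a' (ρ i) = a i := by
  classical
  have hl : ∑ i, Finsupp.single (χ i) (a i) = ∑ i, Finsupp.single (χ' i) (a' i) := by
    refine linearIndependent_monoidHom M ℝ ?_
    rw [map_sum, map_sum]
    simp_rw [Finsupp.linearCombination_single]
    ext m
    simpa using h m
  have hval : ∀ (ψ : ι → M →* ℝ) (b : ι → ℝ) (φ : M →* ℝ),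
      (∑ i, Finsupp.single (ψ i) (b i)) φ = ∑ i, if ψ i = φ then b i else 0 := by
    intro ψ b φ
    rw [Finsupp.finsetSum_apply]
    exact Finset.sum_congr rfl fun i _ => Finsupp.single_apply
  have hχa : ∀ j, ∑ i, (if χ i = χ j then a i else 0) = a j := by
    intro j
    simp [hχ.eq_iff]
  have key : ∀ j, ∑ i, (if χ' i = χ j then a' i else 0) = a j := by
    intro j
    rw [← hval, ← hl, hval, hχa]
  have hex : ∀ j, ∃ i, χ' i = χ j := by
    intro j
    by_contra! hne
    exact ha j (by rw [← key j]; simp [hne])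
  choose ρ hρ using hex
  have hinj : Function.Injective ρ := fun i j hij => hχ (by rw [← hρ i, ← hρ j, hij])
  have hbij : Function.Bijective ρ := Finite.injective_iff_bijective.1 hinj
  refine ⟨Equiv.ofBijective ρ hbij, fun j => ⟨hρ j, ?_⟩⟩
  rw [← key j, Finset.sum_eq_single (ρ j)]
  · simp [hρ j]
  · intro i _ hi
    obtain ⟨k, rfl⟩ := hbij.2 i
    rw [if_neg]
    rw [hρ k]
    exact fun hk => hi (congrArg ρ (hχ hk))
  · simp

section

variable {𝓔 : Type*} {J : ℕ} {D : Finset (List 𝓔)}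

/-- The multiplicative extension of the sentence law of a class to finite sequences of
measurable sets. -/
def sentenceChar (p : Param J D) (z : Fin J) :
    FreeMonoid {B : Set (SentenceObs 𝓔) // MeasurableSet B} →* ℝ :=
  FreeMonoid.lift fun B => (sentenceLaw p z).real B.1

lemma sentenceLaw_eq_of_sentenceChar_eq {D' : Finset (List 𝓔)} {p : Param J D} {p' : Param J D'}
    (hp : p ∈ paramSpace J D) (hp' : p' ∈ paramSpace J D') {z z' : Fin J}
    (h : sentenceChar p z = sentenceChar p' z') : sentenceLaw p z = sentenceLaw p' z' := by
  have := isProbabilityMeasure_sentenceLaw hp z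
  have := isProbabilityMeasure_sentenceLaw hp' z'
  ext B hB
  have h1 := DFunLike.congr_fun h (FreeMonoid.of ⟨B, hB⟩)
  rw [sentenceChar, sentenceChar, FreeMonoid.lift_eval_of, FreeMonoid.lift_eval_of] at h1
  exact (measureReal_eq_measureReal_iff).1 h1

lemma real_law_rectangle {p : Param J D} (hp : p ∈ paramSpace J D)
    (l : List {B : Set (SentenceObs 𝓔) // MeasurableSet B}) :
    (law p).real ((fun s => (⟨l.length, s⟩ : Obs 𝓔)) '' Set.univ.pi fun k => (l.get k).1) =
      p.kappa ^ l.length * Real.exp (-p.kappa) / (l.length.factorial : ℝ) *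
        ∑ z, p.prob z * sentenceChar p z (FreeMonoid.ofList l) := by
  have : ∀ z, IsProbabilityMeasure (sentenceLaw p z) := isProbabilityMeasure_sentenceLaw hp
  have h := law_rectangle hp (B := fun k => (l.get k).1) fun k => (l.get k).2
  rw [measureReal_def]
  refine (congrArg ENNReal.toReal h).trans ?_
  rw [ENNReal.toReal_mul, ENNReal.toReal_ofReal (div_nonneg (mul_nonneg
    (pow_nonneg hp.2.2.2.2.le _) (Real.exp_pos _).le) (by positivity)), ENNReal.toReal_sum]
  · congr 1
    refine Finset.sum_congr rfl fun z _ => ?_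
    rw [ENNReal.toReal_mul, ENNReal.toReal_ofReal (hp.2.2.1 z).le, ENNReal.toReal_prod,
      sentenceChar, FreeMonoid.lift_ofList, ← Fin.prod_univ_fun_getElem]
    rfl
  · exact fun z _ => ENNReal.mul_ne_top ENNReal.ofReal_ne_top
      (ENNReal.prod_ne_top fun k _ => measure_ne_top _ _)

lemma kappa_eq_of_law_eq {D' : Finset (List 𝓔)} {p : Param J D} {p' : Param J D'}
    (hp : p ∈ paramSpace J D) (hp' : p' ∈ paramSpace J D') (h : law p' = law p) :
    p'.kappa = p.kappa := by
  have h1 := real_law_rectangle hp []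
  have h2 := real_law_rectangle hp' []
  rw [h, h1] at h2
  simp [sentenceChar, hp.2.2.2.1, hp'.2.2.2.1] at h2
  exact h2.symm

theorem identifiable (hD : IsDictionary D) {p : Param J D} (hp : p ∈ paramSpace J D)
    (hlt : ∀ j w, p.theta j w < 1) (hused : ∀ w, ∃ j, p.theta j w ≠ 0)
    (hclass : ∀ j, ∃ w, p.theta j w ≠ 0) (hC1 : ConditionC1 p)
    {D' : Finset (List 𝓔)} (hD' : IsDictionary D') (hcard : D'.card ≤ D.card)
    {p' : Param J D'} (hp' : p' ∈ paramSpace J D') (h : law p' = law p) :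
    D' = D ∧ p'.kappa = p.kappa ∧ ∃ ρ : Equiv.Perm (Fin J), ∀ j,
      p'.lam (ρ j) = p.lam j ∧ p'.prob (ρ j) = p.prob j ∧
        ∀ w, p'.thetaExt (ρ j) w = p.thetaExt j w := by
  have hκ := kappa_eq_of_law_eq hp hp' h
  have hinj : Function.Injective (sentenceChar p) := by
    intro i j hij
    by_contra hne
    obtain ⟨hlam, hth⟩ := class_eq_of_sentenceLaw_eq hD hD hp hp (hlt i) (hclass i)
      (sentenceLaw_eq_of_sentenceChar_eq hp hp hij)
    have hi : i ∈ eqClass p j := by simp [eqClass, hlam]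
    have hj : j ∈ eqClass p j := by simp [eqClass]
    obtain ⟨I, _, _, _, _, _, hrank⟩ := hC1 j (Finset.one_lt_card.2 ⟨i, hi, j, hj, hne⟩)
    have := (hrank 0).injective (a₁ := ⟨i, hi⟩) (a₂ := ⟨j, hj⟩) (by
      ext e
      simp [tMatrix, hth])
    exact hne (congrArg Subtype.val this)
  have hsum : ∀ m, ∑ z, p.prob z * sentenceChar p z m = ∑ z, p'.prob z * sentenceChar p' z m := by
    intro m
    have h1 := real_law_rectangle hp (FreeMonoid.toList m)
    have h2 := real_law_rectangle hp' (FreeMonoid.toList m)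
    rw [h, h1, hκ] at h2
    refine mul_left_cancel₀ (div_pos (mul_pos (pow_pos hp.2.2.2.2 _) (Real.exp_pos _))
      (by positivity)).ne' h2
  obtain ⟨ρ, hρ⟩ := exists_perm_of_sum_monoidHom_eq hinj (fun z => (hp.2.2.1 z).ne') hsum
  have hcl : ∀ j, p.lam j = p'.lam (ρ j) ∧ ∀ w, p.thetaExt j w = p'.thetaExt (ρ j) w := fun j =>
    class_eq_of_sentenceLaw_eq hD hD' hp hp' (hlt j) (hclass j)
      (sentenceLaw_eq_of_sentenceChar_eq hp hp' (hρ j).1.symm)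
  have hsub : D ⊆ D' := by
    intro w hw
    by_contra hw'
    obtain ⟨j, hj⟩ := hused ⟨w, hw⟩
    refine hj ?_
    rw [← thetaExt_coe, (hcl j).2, thetaExt_of_notMem _ _ hw']
  exact ⟨(Finset.eq_of_subset_of_card_le hsub hcard).symm, hκ, ρ, fun j =>
    ⟨(hcl j).1.symm, (hρ j).2, fun w => ((hcl j).2 w).symm⟩⟩

end

/-! ### Existence of maximum likelihood estimates -/

section

variable {𝓔 : Type*} {J : ℕ} {D : Finset (List 𝓔)}

lemma finite_dictionaries [Finite 𝓔] (v : ℕ) :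
    {D : Finset (List 𝓔) | IsDictionary D ∧ D.card ≤ v}.Finite := by
  classical
  have := Fintype.ofFinite 𝓔
  have hfin : {w : List 𝓔 | w.length ≤ max 1 (Fintype.card 𝓔)}.Finite :=
    List.finite_length_le 𝓔 _
  refine hfin.toFinset.powerset.finite_toSet.subset ?_
  rintro D ⟨hD, -⟩
  refine Finset.mem_coe.2 (Finset.mem_powerset.2 fun w hw => hfin.mem_toFinset.2 ?_)
  change w.length ≤ max 1 (Fintype.card 𝓔)
  by_cases h : 2 ≤ w.length
  · exact le_max_of_le_right ((hD w hw).2 h).length_le_card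
  · exact le_max_of_le_left (by omega)

lemma continuous_lik (x : Obs 𝓔) : Continuous fun q : Param J D => lik q x := by
  have hs : ∀ z S, Continuous fun q : Param J D => sepProb q z S := by
    intro z S
    refine continuous_const.mul (continuous_finsetProd _ fun w _ => ?_)
    split_ifs <;> unfold Param.theta <;> fun_prop
  have hl : ∀ z s, Continuous fun q : Param J D => sentenceLik q z s := by
    intro z s
    refine (continuous_finsetSum _ fun S _ => hs z S).mul (continuous_finsetProd _ fun u _ => ?_)
    unfold Param.lam
    fun_prop
  refine Continuous.mul (by unfold Param.kappa; fun_prop) (continuous_finsetSum _ fun z _ =>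
    Continuous.mul (by unfold Param.prob; fun_prop) (continuous_finsetProd _ fun k _ => hl z _))

lemma exists_isMLE_candidates [Finite 𝓔] {v : ℕ} {Θ : ∀ D : Finset (List 𝓔), Set (Param J D)}
    (hΘ : ∀ D, IsCompact (Θ D)) {c₀ : Model 𝓔 J} (hc₀ : c₀ ∈ candidates v Θ) {m : ℕ}
    (x : Fin m → Obs 𝓔) : ∃ c, IsMLE (candidates v Θ) x c := by
  classical
  set 𝓓 : Set (Finset (List 𝓔)) := {D | (IsDictionary D ∧ D.card ≤ v) ∧ (Θ D).Nonempty}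
  have hfin : 𝓓.Finite := (finite_dictionaries v).subset fun D hD => hD.1
  have hmax : ∀ D ∈ 𝓓, ∃ q ∈ Θ D, ∀ q' ∈ Θ D, ∏ i, lik q' (x i) ≤ ∏ i, lik q (x i) :=
    fun D hD => (hΘ D).exists_isMaxOn hD.2
      (continuous_finsetProd _ fun i _ => continuous_lik (x i)).continuousOn
  have hex : ∃ c : Model 𝓔 J, c.1 ∈ 𝓓 ∧ c.2 ∈ Θ c.1 ∧
      ∀ c' : Model 𝓔 J, c'.1 ∈ 𝓓 → c'.2 ∈ Θ c'.1 → ∏ i, lik c'.2 (x i) ≤ ∏ i, lik c.2 (x i) := by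
    choose! q hq hqmax using hmax
    have hc₀' : c₀.1 ∈ 𝓓 := ⟨⟨hc₀.1, hc₀.2.1⟩, ⟨c₀.2, hc₀.2.2⟩⟩
    obtain ⟨D, hD, hDmax⟩ := Set.exists_max_image 𝓓 (fun D => ∏ i, lik (q D) (x i)) hfin ⟨_, hc₀'⟩
    exact ⟨⟨D, q D⟩, hD, hq D hD, fun c' h1 h2 =>
      (hqmax c'.1 h1 c'.2 h2).trans (hDmax c'.1 h1)⟩
  obtain ⟨c, hc1, hc2, hc3⟩ := hex
  exact ⟨c, ⟨hc1.1.1, hc1.1.2, hc2⟩, fun c' hc' =>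
    hc3 c' ⟨⟨hc'.1, hc'.2.1⟩, ⟨c'.2, hc'.2.2⟩⟩ hc'.2.2⟩

/-! ### Consistency -/

lemma isOpen_close (p : Param J D) (ρ : Equiv.Perm (Fin J)) (δ : ℝ) :
    IsOpen {q : Param J D | Close p ⟨D, q⟩ ρ δ} := by
  have hth : ∀ j w, Continuous fun q : Param J D => q.thetaExt j w := by
    intro j w
    unfold Param.thetaExt Param.theta
    split_ifs <;> fun_prop
  have hl : ∀ j, Continuous fun q : Param J D => q.lam j := fun j => by unfold Param.lam; fun_prop
  have hpi : ∀ j, Continuous fun q : Param J D => q.prob j := fun j => by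
    unfold Param.prob; fun_prop
  have hk : Continuous fun q : Param J D => q.kappa := by unfold Param.kappa; fun_prop
  have h1 := (hk.sub (continuous_const (y := p.kappa))).abs
  have h2 := (continuous_finsetSum Finset.univ fun j _ =>
    ((hl (ρ j)).sub (continuous_const (y := p.lam j))).pow 2).sqrt
  have h3 := (continuous_finsetSum Finset.univ fun j _ => continuous_finsetSum D fun w _ =>
    ((hth (ρ j) w).sub (continuous_const (y := p.thetaExt j w))).pow 2).sqrt
  have h4 := (continuous_finsetSum Finset.univ fun j _ =>
    ((hpi (ρ j)).sub (continuous_const (y := p.prob j))).pow 2).sqrt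
  exact (isOpen_lt h1 continuous_const).and ((isOpen_lt h2 continuous_const).and
    ((isOpen_lt h3 continuous_const).and (isOpen_lt h4 continuous_const)))

lemma exists_perm_forall_close (p : Param J D) (c : Model 𝓔 J) :
    ∃ ρ : Equiv.Perm (Fin J), ∀ ρ' δ, Close p c ρ' δ → Close p c ρ δ := by
  set d : Equiv.Perm (Fin J) → ℝ := fun ρ => max |c.2.kappa - p.kappa|
    (max (Real.sqrt (∑ j, (c.2.lam (ρ j) - p.lam j) ^ 2))
      (max (Real.sqrt (∑ j, ∑ w ∈ D, (c.2.thetaExt (ρ j) w - p.thetaExt j w) ^ 2))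
        (Real.sqrt (∑ j, (c.2.prob (ρ j) - p.prob j) ^ 2)))) with hd
  have hiff : ∀ ρ δ, Close p c ρ δ ↔ d ρ < δ := by
    intro ρ δ
    simp only [hd, Close, max_lt_iff]
  obtain ⟨ρ, hρ⟩ := Finite.exists_min d
  refine ⟨ρ, fun ρ' δ h => ?_⟩
  rw [hiff] at h ⊢
  exact (hρ ρ').trans_lt h

lemma close_of_eq {p : Param J D} {c : Model 𝓔 J} {ρ : Equiv.Perm (Fin J)}
    (hk : c.2.kappa = p.kappa) (h : ∀ j, c.2.lam (ρ j) = p.lam j ∧ c.2.prob (ρ j) = p.prob j ∧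
      ∀ w, c.2.thetaExt (ρ j) w = p.thetaExt j w) {δ : ℝ} (hδ : 0 < δ) : Close p c ρ δ := by
  simp [Close, hk, h, hδ]

variable {Ω : Type*} [MeasurableSpace Ω] {μ : Measure Ω} [IsProbabilityMeasure μ]

lemma lintegral_lik [Finite 𝓔] {q : Param J D} (hq : q ∈ paramSpace J D) :
    ∫⁻ x, ENNReal.ofReal (lik q x) ∂(obsRef 𝓔) = 1 := by
  have := isProbabilityMeasure_law hq
  rw [← setLIntegral_univ, ← withDensity_apply _ MeasurableSet.univ, ← law_eq_withDensity hq,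
    measure_univ]

lemma measure_exists_lik_le_tendsto_zero [Finite 𝓔] {p : Param J D} (hp : p ∈ paramSpace J D)
    {X : ℕ → Ω → Obs 𝓔} (hXm : ∀ i, Measurable (X i)) (hXind : iIndepFun X μ)
    (hXlaw : ∀ i, μ.map (X i) = law p) {D' : Finset (List 𝓔)} {C : Set (Param J D')}
    (hC : IsCompact C) (hCsub : C ⊆ paramSpace J D') (hne : ∀ q ∈ C, law q ≠ law p) :
    Tendsto (fun m : ℕ => μ {ω | ∃ q ∈ C, ∏ i : Fin m, lik p (X i ω) ≤ ∏ i : Fin m, lik q (X i ω)})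
      atTop (𝓝 0) := by
  obtain ⟨G, hG, hCG⟩ := exists_dominating hC hCsub
  have h := measure_exists_prod_le_tendsto_zero (ν := obsRef 𝓔) (μ := μ)
    (f := fun (q : Param J D') x => ENNReal.ofReal (lik q x))
    (g := fun x => ENNReal.ofReal (lik p x)) (G := G)
    (fun q => (measurable_lik q).ennreal_ofReal)
    (fun x => ENNReal.continuous_ofReal.comp (continuous_lik x))
    (fun _ _ => ENNReal.ofReal_ne_top) (measurable_lik p).ennreal_ofReal
    (fun _ => ENNReal.ofReal_ne_top) (lintegral_lik hp).le hC
    (fun q hq => (lintegral_lik (hCsub hq)).le) hG hCG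
    (fun q hq hae => hne q hq (by
      rw [law_eq_withDensity (hCsub hq), law_eq_withDensity hp]
      exact withDensity_congr_ae hae))
    hXm hXind (fun i => (hXlaw i).trans (law_eq_withDensity hp))
  refine tendsto_of_tendsto_of_tendsto_of_le_of_le tendsto_const_nhds h (fun _ => zero_le)
    fun m => measure_mono ?_
  rintro ω ⟨q, hq, hω⟩
  refine ⟨q, hq, ?_⟩
  rw [← ENNReal.ofReal_prod_of_nonneg fun i _ => lik_nonneg hp _,
    ← ENNReal.ofReal_prod_of_nonneg fun i _ => lik_nonneg (hCsub hq) _]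
  exact ENNReal.ofReal_le_ofReal hω

lemma probTendsToOne_exists_close [Finite 𝓔] {v : ℕ} (hD : IsDictionary D) (hcard : D.card = v)
    {p : Param J D} (hp : p ∈ paramSpace J D)
    (hlt : ∀ j w, p.theta j w < 1) (hused : ∀ w, ∃ j, p.theta j w ≠ 0)
    (hclass : ∀ j, ∃ w, p.theta j w ≠ 0) (hC1 : ConditionC1 p)
    {X : ℕ → Ω → Obs 𝓔} (hXm : ∀ i, Measurable (X i)) (hXind : iIndepFun X μ)
    (hXlaw : ∀ i, μ.map (X i) = law p) {Θ : ∀ D' : Finset (List 𝓔), Set (Param J D')}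
    (hΘ : ∀ D', IsCompact (Θ D')) (hΘsub : ∀ D', Θ D' ⊆ paramSpace J D')
    {P : Set (Model 𝓔 J)} (hP : P ⊆ candidates v Θ) (hpP : (⟨D, p⟩ : Model 𝓔 J) ∈ P)
    {est : ℕ → Ω → Model 𝓔 J}
    (hest : ∀ m, ∀ᵐ ω ∂μ, IsMLE P (fun i : Fin m => X i ω) (est m ω)) {δ : ℝ} (hδ : 0 < δ) :
    ProbTendsToOne μ (fun m => {ω | (est m ω).1 = D ∧ ∃ ρ, Close p (est m ω) ρ δ}) := by
  classical
  set C : ∀ D' : Finset (List 𝓔), Set (Param J D') := fun D' =>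
    {q | q ∈ Θ D' ∧ ¬ (D' = D ∧ ∃ ρ, Close p ⟨D', q⟩ ρ δ)} with hC
  have hCc : ∀ D', IsCompact (C D') := by
    intro D'
    by_cases h : D' = D
    · subst h
      refine (hΘ D').of_isClosed_subset ?_ fun q hq => hq.1
      have hopen : IsOpen {q : Param J D' | ∃ ρ, Close p ⟨D', q⟩ ρ δ} := by
        have : {q : Param J D' | ∃ ρ, Close p ⟨D', q⟩ ρ δ} =
            ⋃ ρ, {q : Param J D' | Close p ⟨D', q⟩ ρ δ} := by
          ext q
          rw [Set.mem_iUnion]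
          rfl
        rw [this]
        exact isOpen_iUnion fun ρ => isOpen_close p ρ δ
      have : C D' = Θ D' ∩ {q : Param J D' | ∃ ρ, Close p ⟨D', q⟩ ρ δ}ᶜ := by
        ext q
        exact and_congr_right fun _ => not_congr (and_iff_right rfl)
      rw [this]
      exact (hΘ D').isClosed.inter hopen.isClosed_compl
    · have : C D' = Θ D' := by
        ext q
        exact and_iff_left fun h' => h h'.1
      rw [this]
      exact hΘ D'
  set 𝓓 : Finset (Finset (List 𝓔)) := (finite_dictionaries (𝓔 := 𝓔) v).toFinset with h𝓓
  have hmem : ∀ D', D' ∈ 𝓓 ↔ IsDictionary D' ∧ D'.card ≤ v := fun D' => by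
    rw [h𝓓, Set.Finite.mem_toFinset]; rfl
  have hlim : ∀ D' ∈ 𝓓, Tendsto (fun m : ℕ => μ {ω | ∃ q ∈ C D',
      ∏ i : Fin m, lik p (X i ω) ≤ ∏ i : Fin m, lik q (X i ω)}) atTop (𝓝 0) := by
    intro D' hD'
    obtain ⟨h1, h2⟩ := (hmem D').1 hD'
    refine measure_exists_lik_le_tendsto_zero hp hXm hXind hXlaw (hCc D')
      (fun q hq => hΘsub D' hq.1) fun q hq hlaw => hq.2 ?_
    obtain ⟨e, hk, ρ, hρ⟩ := identifiable hD hp hlt hused hclass hC1 h1 (hcard ▸ h2)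
      (hΘsub D' hq.1) hlaw
    exact ⟨e, ρ, close_of_eq hk hρ hδ⟩
  have hsum : Tendsto (fun m : ℕ => ∑ D' ∈ 𝓓, μ {ω | ∃ q ∈ C D',
      ∏ i : Fin m, lik p (X i ω) ≤ ∏ i : Fin m, lik q (X i ω)}) atTop (𝓝 0) := by
    simpa using tendsto_finsetSum 𝓓 hlim
  refine tendsto_of_tendsto_of_tendsto_of_le_of_le tendsto_const_nhds hsum (fun _ => zero_le)
    fun m => ?_
  refine le_trans (measure_mono_ae ?_) (measure_biUnion_finset_le 𝓓 _)
  filter_upwards [hest m] with ω hω hbad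
  have hcand := hP hω.1
  refine Set.mem_iUnion₂.2 ⟨(est m ω).1, (hmem _).2 ⟨hcand.1, hcand.2.1⟩, (est m ω).2,
    ⟨hcand.2.2, hbad⟩, hω.2 _ hpP⟩

end

end LTDM

end

theorem theorem2 {𝓔 : Type*} [Finite 𝓔] {J : ℕ}
    {Ω : Type*} [MeasurableSpace Ω] (μ : MeasureTheory.Measure Ω)
    [MeasureTheory.IsProbabilityMeasure μ]
    -- the true dictionary, of known size, and the true parameter vector
    (vD : ℕ) (D : Finset (List 𝓔)) (p : LTDM.Param J D)
    (hD : LTDM.IsDictionary D) (hcard : D.card = vD)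
    (hp : p ∈ LTDM.paramSpace J D)
    (hlt : ∀ j w, p.theta j w < 1)
    (hused : ∀ w, ∃ j, p.theta j w ≠ 0)
    (hclass : ∀ j, ∃ w, p.theta j w ≠ 0)
    (hA1 : LTDM.AssumptionA1 p) (hC1 : LTDM.ConditionC1 p) (hC2 : LTDM.ConditionC2 p)
    -- independent examinees
    (X : ℕ → Ω → LTDM.Obs 𝓔) (hXm : ∀ i, Measurable (X i))
    (hXind : ProbabilityTheory.iIndepFun X μ)
    (hXlaw : ∀ i, μ.map (X i) = LTDM.law p)
    -- compact parameter sets containing the true parameter vector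
    (Θ : ∀ D' : Finset (List 𝓔), Set (LTDM.Param J D'))
    (hΘ : ∀ D', IsCompact (Θ D')) (hΘsub : ∀ D', Θ D' ⊆ LTDM.paramSpace J D')
    (hpΘ : p ∈ Θ D) :
    -- the likelihood has a maximizer over the whole candidate set
    (∀ (m : ℕ) (x : Fin m → LTDM.Obs 𝓔), ∃ c, LTDM.IsMLE (LTDM.candidates vD Θ) x c) ∧
    -- consistency, also when only a part `P` of the candidates is admitted (for instance those that
    -- satisfy Assumption A1), as long as the true model belongs to it
    ∀ P ⊆ LTDM.candidates vD Θ, (⟨D, p⟩ : LTDM.Model 𝓔 J) ∈ P →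
      ∀ est : ℕ → Ω → LTDM.Model 𝓔 J,
        (∀ m, ∀ᵐ ω ∂μ, LTDM.IsMLE P (fun i : Fin m => X i ω) (est m ω)) →
        LTDM.ProbTendsToOne μ (fun m => {ω | (est m ω).1 = D}) ∧
        ∃ ρ : ℕ → Ω → Equiv.Perm (Fin J), ∀ δ : ℝ, 0 < δ →
          LTDM.ProbTendsToOne μ
            (fun m => {ω | (est m ω).1 = D ∧ LTDM.Close p (est m ω) (ρ m ω) δ}) := by
  have hcand : (⟨D, p⟩ : LTDM.Model 𝓔 J) ∈ LTDM.candidates vD Θ := ⟨hD, hcard.le, hpΘ⟩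
  refine ⟨fun m x => LTDM.exists_isMLE_candidates hΘ hcand x, fun P hP hpP est hest => ?_⟩
  have h := fun δ (hδ : 0 < δ) => LTDM.probTendsToOne_exists_close hD hcard hp hlt hused hclass hC1
    hXm hXind hXlaw hΘ hΘsub hP hpP hest hδ (δ := δ)
  have hmono : ∀ {A B : ℕ → Set Ω}, (∀ m, A m ⊆ B m) → LTDM.ProbTendsToOne μ A →
      LTDM.ProbTendsToOne μ B := fun hAB hA =>
    tendsto_of_tendsto_of_tendsto_of_le_of_le tendsto_const_nhds hA (fun _ => zero_le)
      fun m => measure_mono (Set.compl_subset_compl.2 (hAB m))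
  refine ⟨hmono (fun m ω hω => hω.1) (h 1 one_pos), ?_⟩
  choose ρ hρ using fun m ω => LTDM.exists_perm_forall_close p (est m ω)
  refine ⟨ρ, fun δ hδ => hmono (fun m ω hω => ?_) (h δ hδ)⟩
  obtain ⟨ρ', hρ'⟩ := hω.2
  exact ⟨hω.1, hρ m ω ρ' δ hρ'⟩
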